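/- Let LOG be a logic given by formulas, which are words over a finite alphabet, and by inference rules on sequents $\Gamma\vdash\Delta$, where $\Gamma,\Delta$ are finite multisets of formulas; a sequent is valid if it has a derivation. Assume that LOG is affine, i.e. admits weakening: if $\Gamma\vdash\Delta$ is provable then so is $\Gamma,A\vdash\Delta$, for every formula $A$. An individual resource game $G=(N,\gamma_1,\dots,\gamma_n,\epsilon_1,\dots,\epsilon_n)$ consists of players $N=\{1,\dots,n\}$, a formula $\gamma_i$ (goal) and a finite multiset of formulas $\epsilon_i$ (endowment) for each player $i$. A profile is a tuple $P=(P_1,\dots,P_n)$ of multisets with $P_i\subseteq\epsilon_i$; its outcome is the multiset union $\mathsf{out}(P)=\biguplus_i P_i$, and $(P_{-i},C)$ denotes $P$ with $P_i$ replaced by $C$. Player $i$ (parsimoniously) strongly prefers $P$ over $Q$ iff (a) $\mathsf{out}(P)\vdash\gamma_i$ and $\mathsf{out}(Q)\not\vdash\gamma_i$; or (b) $P_i\subsetneq Q_i$ and either both or neither of $\mathsf{out}(P)\vdash\gamma_i$, $\mathsf{out}(Q)\vdash\gamma_i$ hold. $P$ is a Nash equilibrium, $P\in NE(G)$, iff there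 are no player $i$ and no $C\subseteq\epsilon_i$ such that $i$ strongly prefers $(P_{-i},C)$ over $P$. Then: 1. For every individual resource game $G$ and every profile $P$ of $G$, $P\notin NE(G)$ if and only if there is a player $i$ such that (i) $\mathsf{out}(P)\not\vdash\gamma_i$ and $P_i\neq\emptyset$; or (ii) $\mathsf{out}(P)\not\vdash\gamma_i$ and $\mathsf{out}((P_{-i},\epsilon_i))\vdash\gamma_i$; or (iii) $\mathsf{out}(P)\vdash\gamma_i$ and there is $A\in P_i$ with $\mathsf{out}((P_{-i},P_i\setminus\{A\}))\vdash\gamma_i$ (one occurrence of $A$ is removed). 2. If the problem of deciding whether a given sequent of LOG is valid is in $\mathsf{NP}$, then the problem of deciding, given $G$ and a profile $P$ of $G$, whether $P\in NE(G)$ is in $\mathsf{P}^{\mathsf{NP}||}$, the class of problems decidable in deterministic polynomial time with non-adaptive (parallel) queries to an $\mathsf{NP}$ oracle. 3. If the problem of deciding whether a given sequent of LOG is valid is in $\mathsf{PSPACE}$, then the problem of deciding, given $G$ and a profile $P$ of $G$, whether $P\in NE(G)$ is in $\mathsf{PSPACE}$. -/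

import Mathlib

open Computability Turing

namespace IRG

/-! ### Decision problems and complexity classes

The machine model is Mathlib's `Turing.FinTM2`: deterministic multi-stack Turing machines with
finitely many stacks, labels and internal states. -/

/-- A decision problem: instances, written as words over a finite alphabet, and a yes/no
question about them. As in Mathlib's `TM2ComputableInPolyTime`, an algorithm for it has to give the
right answer, within its resource bound, on every word that encodes an instance. -/
structure DecisionProblem where
  Inst : Type
  Sym : Type
  [symFin : Fintype Sym]
  enc : Encoding Inst Sym
  Yes : Inst → Prop

/-- The correct answer to an instance, as a Boolean. -/
noncomputable def DecisionProblem.answer (A : DecisionProblem) (x : A.Inst) : Bool :=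
  @decide (A.Yes x) (Classical.propDecidable _)

/-- `f` is computed by a deterministic Turing machine in time polynomial in the length of the
encoded argument. -/
def PolyTime {α β Γ₁ Γ₂ : Type} (ea : Encoding α Γ₁) (eb : Encoding β Γ₂) (f : α → β) : Prop :=
  Nonempty (TM2ComputableInPolyTime ea.encode eb.encode f)

/-- Encoding of a pair consisting of an object and a word of bits. -/
def withBits {α Γ : Type} (e : Encoding α Γ) : Encoding (α × List Bool) (Γ ⊕ Bool) :=
  encodingProd e (encodingList Bool)

/-- `NP`: yes-instances are those with a certificate of polynomial length that is accepted by a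
polynomial-time verifier. -/
def InNP (A : DecisionProblem) : Prop :=
  ∃ (p : Polynomial ℕ) (V : A.Inst × List Bool → Bool),
    PolyTime (withBits A.enc) encodingBoolBool V ∧
    ∀ x, A.Yes x ↔
      ∃ w : List Bool, w.length ≤ p.eval (A.enc.encode x).length ∧ V (x, w) = true

/-- Total length of the stacks of a configuration. -/
def cfgSpace (M : FinTM2) (c : M.Cfg) : ℕ :=
  letI := M.kFin
  ∑ k : M.K, (TM2.Cfg.stk c k).length

/-- `PSPACE`: some deterministic Turing machine answers every instance, and on every instance
all configurations of its run have size polynomially bounded in the length of the input. -/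
def InPSPACE (A : DecisionProblem) : Prop :=
  ∃ (M : TM2ComputableAux A.Sym Bool) (p : Polynomial ℕ), ∀ x : A.Inst,
    let input := (A.enc.encode x).map M.inputAlphabet.symm
    Nonempty (TM2Outputs M.tm input
      (some ((encodeBool (A.answer x)).map M.outputAlphabet.symm))) ∧
    ∀ c, StateTransition.Reaches M.tm.step (initList M.tm input) c →
      cfgSpace M.tm c ≤ p.eval (A.enc.encode x).length

/-- Two words followed by a separator agree only if they are equal. -/
theorem map_some_append_none {Γ : Type} :
    ∀ (w w' : List Γ) (u u' : List (Option Γ)),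
      w.map some ++ none :: u = w'.map some ++ none :: u' → w = w' ∧ u = u'
  | [], [], _, _, h => by simpa using h
  | [], _ :: _, _, _, h => by simp at h
  | _ :: _, [], _, _, h => by simp at h
  | a :: w, b :: w', u, u', h => by
    simp only [List.map_cons, List.cons_append, List.cons.injEq, Option.some.injEq] at h
    obtain ⟨h1, h2⟩ := map_some_append_none w w' u u' h.2
    exact ⟨by rw [h.1, h1], h2⟩

/-- A list is written by writing its entries one after the other, each followed by a fresh
separator `none`. -/
def listWord {α Γ : Type} (e : Encoding α Γ) (l : List α) : List (Option Γ) :=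
  l.flatMap fun a => (e.encode a).map some ++ [none]

theorem listWord_injective {α Γ : Type} (e : Encoding α Γ) :
    Function.Injective (listWord e) := by
  intro l
  induction l with
  | nil =>
    intro l' h
    cases l' with
    | nil => rfl
    | cons b l' => simp [listWord] at h
  | cons a l ih =>
    intro l' h
    cases l' with
    | nil => simp [listWord] at h
    | cons b l' =>
      simp only [listWord, List.flatMap_cons, List.append_assoc, List.singleton_append] at h
      obtain ⟨h1, h2⟩ := map_some_append_none _ _ _ _ h
      rw [e.encode_injective h1, ih h2]

/-- The encoding with a given injective encoding function. -/
noncomputable def encodingOfInjective {α Γ : Type} (f : α → List Γ)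
    (hf : Function.Injective f) : Encoding α Γ where
  encode := f
  decode := Function.partialInv f
  decode_encode := Function.partialInv_left hf

/-- The encoding `listWord` of lists. -/
noncomputable def listEnc {α Γ : Type} (e : Encoding α Γ) : Encoding (List α) (Option Γ) :=
  encodingOfInjective (listWord e) (listWord_injective e)

/-- `P^{C||}`: a polynomial-time machine first writes down, from the input `x` alone, the list
`q x` of all its queries to some problem `B` of the class `C`; it is then given all the answers
at once and decides in polynomial time from `x` and the answers. -/
def InParallelP (C : DecisionProblem → Prop) (A : DecisionProblem) : Prop :=
  ∃ B : DecisionProblem, C B ∧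
    ∃ (q : A.Inst → List B.Inst) (ev : A.Inst × List Bool → Bool),
      PolyTime A.enc (listEnc B.enc) q ∧
      PolyTime (withBits A.enc) encodingBoolBool ev ∧
      ∀ x, A.Yes x ↔ ev (x, (q x).map B.answer) = true

/-! ### Resource logics -/

/-- A sequent `ant ⊢ suc` between finite multisets of formulas. -/
structure Sequent (F : Type) where
  ant : Multiset F
  suc : Multiset F

/-- A logic: formulas, written as words over a finite alphabet, and inference rules, given as
the set of their instances `(premises, conclusion)`. -/
structure ResourceLogic where
  Form : Type
  Sym : Type
  [symFin : Fintype Sym]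
  enc : Encoding Form Sym
  rules : Set (List (Sequent Form) × Sequent Form)

namespace ResourceLogic

noncomputable instance (L : ResourceLogic) : DecidableEq L.Form := Classical.decEq _

instance (L : ResourceLogic) : Fintype L.Sym := L.symFin

/-- Sequents that have a (finite) proof tree built from the rules. -/
inductive Derivable (L : ResourceLogic) : Sequent L.Form → Prop
  | infer (premises : List (Sequent L.Form)) (s : Sequent L.Form)
      (h : (premises, s) ∈ L.rules) (hp : ∀ t ∈ premises, Derivable L t) : Derivable L s

/-- `Γ ⊢ Δ` is provable in `L`. -/
def Provable (L : ResourceLogic) (Γ Δ : Multiset L.Form) : Prop := L.Derivable ⟨Γ, Δ⟩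

/-- The logic is affine: it admits (left) weakening. -/
def Affine (L : ResourceLogic) : Prop :=
  ∀ (Γ Δ : Multiset L.Form) (A : L.Form), L.Provable Γ Δ → L.Provable (A ::ₘ Γ) Δ

/-- Sequent validity checking: given `Γ` and `Δ` (written as lists), is `Γ ⊢ Δ` provable? -/
noncomputable def validity (L : ResourceLogic) : DecisionProblem where
  Inst := List L.Form × List L.Form
  Sym := Option (Option L.Sym)
  enc := encodingOfInjective
    (fun s => (listEnc (listEnc L.enc)).encode [s.1, s.2])
    (fun s t h => by
      have h' := (listEnc (listEnc L.enc)).encode_injective h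
      simp only [List.cons.injEq, and_true] at h'
      exact Prod.ext h'.1 h'.2)
  Yes s := L.Provable s.1 s.2

end ResourceLogic

/-! ### Individual resource games with parsimonious preferences -/

/-- An individual resource game with players `Fin n`. -/
structure Game (L : ResourceLogic) where
  n : ℕ
  goal : Fin n → L.Form
  endow : Fin n → Multiset L.Form

namespace Game

variable {L : ResourceLogic} (G : Game L)

/-- The actions of player `i`: the sub-multisets of her endowment. -/
def ch (i : Fin G.n) : Set (Multiset L.Form) := {C | C ≤ G.endow i}

/-- The profiles of the game. -/
def profiles : Set (Fin G.n → Multiset L.Form) := {P | ∀ i, P i ∈ G.ch i}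

/-- The outcome of a profile: the multiset union of the actions. -/
def out (P : Fin G.n → Multiset L.Form) : Multiset L.Form := ∑ i, P i

/-- Player `i` realizes her goal in the profile `P`. -/
def Sat (P : Fin G.n → Multiset L.Form) (i : Fin G.n) : Prop :=
  L.Provable (G.out P) {G.goal i}

/-- Player `i` parsimoniously strongly prefers `P` over `Q`. -/
def StronglyPrefers (i : Fin G.n) (P Q : Fin G.n → Multiset L.Form) : Prop :=
  (¬ G.Sat P i ∧ ¬ G.Sat Q i ∧ P i < Q i) ∨
  (G.Sat P i ∧ ¬ G.Sat Q i) ∨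
  (G.Sat P i ∧ G.Sat Q i ∧ P i < Q i)

/-- The profile `(P_{-i}, C)`. -/
def deviate (P : Fin G.n → Multiset L.Form) (i : Fin G.n) (C : Multiset L.Form) :
    Fin G.n → Multiset L.Form := Function.update P i C

/-- The set of Nash equilibria. -/
def NE : Set (Fin G.n → Multiset L.Form) :=
  {P | P ∈ G.profiles ∧ ∀ i, ∀ C ∈ G.ch i, ¬ G.StronglyPrefers i (G.deviate P i C) P}

end Game

/-- The data of one player in a written instance of NASH EQUILIBRIUM; multisets are written as
lists. -/
structure PlayerData (F : Type) where
  goal : F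
  endow : List F
  choice : List F

/-- A written instance of NASH EQUILIBRIUM: a game together with one of its profiles. -/
structure NEInstance (L : ResourceLogic) where
  players : List (PlayerData L.Form)
  choice_le : ∀ d ∈ players, (d.choice : Multiset L.Form) ≤ (d.endow : Multiset L.Form)

namespace NEInstance

variable {L : ResourceLogic}

/-- The game of an instance. -/
def game (I : NEInstance L) : Game L where
  n := I.players.length
  goal i := (I.players.get i).goal
  endow i := ((I.players.get i).endow : Multiset L.Form)

/-- The profile of an instance. -/
def profile (I : NEInstance L) (i : Fin I.game.n) : Multiset L.Form :=
  ((I.players.get i).choice : Multiset L.Form)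

theorem profile_mem (I : NEInstance L) : I.profile ∈ I.game.profiles :=
  fun i => I.choice_le _ (List.get_mem I.players i)

/-- An instance is written as the list of its players, each of them given as the list
`[goal], endowment, choice`. -/
noncomputable def enc (L : ResourceLogic) :
    Encoding (NEInstance L) (Option (Option (Option L.Sym))) :=
  encodingOfInjective
    (fun I => (listEnc (listEnc (listEnc L.enc))).encode
      (I.players.map fun d => [[d.goal], d.endow, d.choice]))
    (fun I J h => by
      have h' := (listEnc (listEnc (listEnc L.enc))).encode_injective h
      have hinj : Function.Injective
          (fun d : PlayerData L.Form => [[d.goal], d.endow, d.choice]) := by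
        rintro ⟨g, e, c⟩ ⟨g', e', c'⟩ hd
        simpa using hd
      cases I
      cases J
      congr
      exact List.map_injective_iff.mpr hinj h')

end NEInstance

/-- The decision problem NASH EQUILIBRIUM: given a game and a profile of it, is the profile a
Nash equilibrium? -/
noncomputable def nashEquilibrium (L : ResourceLogic) : DecisionProblem where
  Inst := NEInstance L
  Sym := Option (Option (Option L.Sym))
  enc := NEInstance.enc L
  Yes I := I.profile ∈ I.game.NE

/-! ### Example: Affine MALL and its fragments

The theorem is about an arbitrary affine logic. The sequent calculus Affine MALL, restricted to
an arbitrary class of formulas (for instance those of MLL), is such a logic. -/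

/-- Formulas of MALL, with atoms named by binary words. -/
inductive MALL
  | top | zero | one | bot
  | atom (name : List Bool)
  | neg (A : MALL)
  | par (A B : MALL)
  | tensor (A B : MALL)
  | lolli (A B : MALL)
  | with_ (A B : MALL)
  | plus (A B : MALL)

namespace MALL

/-- Polish notation. -/
def word : MALL → List (Fin 11 ⊕ Bool)
  | top => [.inl 0]
  | zero => [.inl 1]
  | one => [.inl 2]
  | bot => [.inl 3]
  | atom w => w.map .inr ++ [.inl 4]
  | neg A => .inl 5 :: A.word
  | par A B => .inl 6 :: (A.word ++ B.word)
  | tensor A B => .inl 7 :: (A.word ++ B.word)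
  | lolli A B => .inl 8 :: (A.word ++ B.word)
  | with_ A B => .inl 9 :: (A.word ++ B.word)
  | plus A B => .inl 10 :: (A.word ++ B.word)

theorem atom_word : ∀ (w w' : List Bool) (s t : List (Fin 11 ⊕ Bool)),
    w.map .inr ++ .inl 4 :: s = w'.map .inr ++ .inl 4 :: t → w = w' ∧ s = t
  | [], [], _, _, h => by simpa using h
  | [], _ :: _, _, _, h => by simp at h
  | _ :: _, [], _, _, h => by simp at h
  | a :: w, b :: w', s, t, h => by
    simp only [List.map_cons, List.cons_append, List.cons.injEq, Sum.inr.injEq] at h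
    obtain ⟨h1, h2⟩ := atom_word w w' s t h.2
    exact ⟨by rw [h.1, h1], h2⟩

theorem word_append_inj (A : MALL) : ∀ (B : MALL) (s t : List (Fin 11 ⊕ Bool)),
    A.word ++ s = B.word ++ t → A = B ∧ s = t := by
  induction A with
  | atom w =>
    intro B s t h
    cases B with
    | atom w' =>
      simp only [word, List.append_assoc, List.singleton_append] at h
      simpa using atom_word w w' s t h
    | _ => cases w <;> simp [word] at h
  | neg A ih =>
    intro B s t h
    cases B with
    | neg B =>
      simp only [word, List.cons_append, List.cons.injEq, true_and] at h
      simpa using ih B s t h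
    | atom w' => cases w' <;> simp [word] at h
    | _ => simp [word] at h
  | par A₁ A₂ ih₁ ih₂ | tensor A₁ A₂ ih₁ ih₂ | lolli A₁ A₂ ih₁ ih₂ | with_ A₁ A₂ ih₁ ih₂
  | plus A₁ A₂ ih₁ ih₂ =>
    intro B s t h
    cases B with
    | atom w' => cases w' <;> simp [word] at h
    | par B₁ B₂ | tensor B₁ B₂ | lolli B₁ B₂ | with_ B₁ B₂ | plus B₁ B₂ =>
      simp [word] at h
      try
        obtain ⟨h1, h2⟩ := ih₁ _ _ _ h
        obtain ⟨h3, h4⟩ := ih₂ _ _ _ h2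
        exact ⟨by rw [h1, h3], h4⟩
    | _ => simp [word] at h
  | _ =>
    intro B s t h
    cases B with
    | atom w' => cases w' <;> simp [word] at h
    | _ => simp_all [word]

theorem word_injective : Function.Injective word := fun A B h =>
  (word_append_inj A B [] [] (by simpa using h)).1

/-- The rules of Affine MALL; exchange is built into the use of multisets. -/
inductive Rule : List (Sequent MALL) → Sequent MALL → Prop
  | ax (A) : Rule [] ⟨{A}, {A}⟩
  | cut (Γ Γ' Δ Δ' A) : Rule [⟨A ::ₘ Γ, Δ⟩, ⟨Γ', A ::ₘ Δ'⟩] ⟨Γ + Γ', Δ + Δ'⟩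
  | weakL (Γ Δ A) : Rule [⟨Γ, Δ⟩] ⟨A ::ₘ Γ, Δ⟩
  | weakR (Γ Δ A) : Rule [⟨Γ, Δ⟩] ⟨Γ, A ::ₘ Δ⟩
  | negL (Γ Δ A) : Rule [⟨Γ, A ::ₘ Δ⟩] ⟨neg A ::ₘ Γ, Δ⟩
  | negR (Γ Δ A) : Rule [⟨A ::ₘ Γ, Δ⟩] ⟨Γ, neg A ::ₘ Δ⟩
  | tensorR (Γ Γ' Δ Δ' A B) :
      Rule [⟨Γ, A ::ₘ Δ⟩, ⟨Γ', B ::ₘ Δ'⟩] ⟨Γ + Γ', tensor A B ::ₘ (Δ + Δ')⟩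
  | tensorL (Γ Δ A B) : Rule [⟨A ::ₘ B ::ₘ Γ, Δ⟩] ⟨tensor A B ::ₘ Γ, Δ⟩
  | parL (Γ Γ' Δ Δ' A B) :
      Rule [⟨A ::ₘ Γ, Δ⟩, ⟨B ::ₘ Γ', Δ'⟩] ⟨par A B ::ₘ (Γ + Γ'), Δ + Δ'⟩
  | parR (Γ Δ A B) : Rule [⟨Γ, A ::ₘ B ::ₘ Δ⟩] ⟨Γ, par A B ::ₘ Δ⟩
  | lolliL (Γ Γ' Δ Δ' A B) :
      Rule [⟨Γ, A ::ₘ Δ⟩, ⟨B ::ₘ Γ', Δ'⟩] ⟨lolli A B ::ₘ (Γ + Γ'), Δ + Δ'⟩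
  | lolliR (Γ Δ A B) : Rule [⟨A ::ₘ Γ, B ::ₘ Δ⟩] ⟨Γ, lolli A B ::ₘ Δ⟩
  | oneL (Γ Δ) : Rule [⟨Γ, Δ⟩] ⟨one ::ₘ Γ, Δ⟩
  | oneR : Rule [] ⟨0, {one}⟩
  | botL : Rule [] ⟨{bot}, 0⟩
  | botR (Γ Δ) : Rule [⟨Γ, Δ⟩] ⟨Γ, bot ::ₘ Δ⟩
  | withR (Γ Δ A B) : Rule [⟨Γ, A ::ₘ Δ⟩, ⟨Γ, B ::ₘ Δ⟩] ⟨Γ, with_ A B ::ₘ Δ⟩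
  | withL₀ (Γ Δ A B) : Rule [⟨A ::ₘ Γ, Δ⟩] ⟨with_ A B ::ₘ Γ, Δ⟩
  | withL₁ (Γ Δ A B) : Rule [⟨B ::ₘ Γ, Δ⟩] ⟨with_ A B ::ₘ Γ, Δ⟩
  | plusL (Γ Δ A B) : Rule [⟨A ::ₘ Γ, Δ⟩, ⟨B ::ₘ Γ, Δ⟩] ⟨plus A B ::ₘ Γ, Δ⟩
  | plusR₀ (Γ Δ A B) : Rule [⟨Γ, A ::ₘ Δ⟩] ⟨Γ, plus A B ::ₘ Δ⟩
  | plusR₁ (Γ Δ A B) : Rule [⟨Γ, B ::ₘ Δ⟩] ⟨Γ, plus A B ::ₘ Δ⟩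
  | topR (Γ Δ) : Rule [] ⟨Γ, top ::ₘ Δ⟩
  | zeroL (Γ Δ) : Rule [] ⟨zero ::ₘ Γ, Δ⟩

/-- Affine MALL restricted to the formulas in `F`. -/
noncomputable def affineFragment (F : Set MALL) : ResourceLogic where
  Form := F
  Sym := Fin 11 ⊕ Bool
  enc := encodingOfInjective (fun A : F => A.1.word)
    (fun _ _ h => Subtype.ext (word_injective h))
  rules := {r | Rule (r.1.map fun s => ⟨s.ant.map (↑), s.suc.map (↑)⟩)
    ⟨r.2.ant.map (↑), r.2.suc.map (↑)⟩}

theorem affineFragment_affine (F : Set MALL) : (affineFragment F).Affine := by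
  intro Γ Δ A h
  refine .infer [⟨Γ, Δ⟩] _ ?_ (fun t ht => by rw [List.mem_singleton.1 ht]; exact h)
  have e : Multiset.map Subtype.val ((A : F) ::ₘ (Γ : Multiset F)) =
      A.1 ::ₘ Multiset.map Subtype.val (Γ : Multiset F) := Multiset.map_cons _ _ _
  change Rule [⟨Multiset.map Subtype.val (Γ : Multiset F), _⟩]
    ⟨Multiset.map Subtype.val ((A : F) ::ₘ (Γ : Multiset F)), _⟩
  rw [e]
  exact Rule.weakL _ _ _

end MALL

end IRG

/-! The characterization is a matter of monotonicity. In an affine logic, provability of a goal is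
monotone in the outcome (`ResourceLogic.Affine.mono`), so only three deviations of a player matter.
If some choice reaches an unrealized goal, so does the whole endowment. If some strictly smaller
choice keeps a realized goal, so does the removal of a single formula. If the goal is unrealized and
the choice is nonempty, the empty choice is better: it either realizes the goal or fails it more
cheaply. This is `Game.not_mem_NE_iff`.

Hence a number of validity questions linear in the input, all known in advance, settles whether a
profile is an equilibrium. The reduction does not care how hard validity is: for every class `C`
containing it, NASH EQUILIBRIUM lies in `InParallelP C` (`inParallelP_nashEquilibrium`). With NP for
`C` this is the second claim; with PSPACE it gives the third, because P^{PSPACE||} is contained in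
PSPACE (`InParallelP.inPSPACE`).

The query writer asks one question for every position of the input word, relevant or not. A mark
travels through the word, and two finite transducers turn the marked word into a sequent: `fwdOut`,
reading from the left, selects the antecedent, and `bwdOut`, reading from the right, extracts the
goal of the marked player. Every mark yields a well-formed sequent (`exists_query_eq`), and the
marks on the ends of formulas and lists yield the sequents that are needed (`query_goal`,
`query_choice`, `query_endow`). The verdict is computed by a finite automaton, `evStep`, that reads
the word from the right together with the answers (`evState_word`).

For the closure of PSPACE, a host machine runs the query writer, then the solver on each query, then
the judge (`Host.run_machine`). The list of queries is polynomially long because its writer runs in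
polynomial time, and each guest halts in its initial state with only its output left on its stacks.
So the solver can be restarted in the same space, and the bounds simply add up. -/

namespace IRG

/-! ### Runs of state transition systems -/

/-- `b` is reached from `a` in at most `n` steps of `f`. -/
inductive StepsWithin {α : Type*} (f : α → Option α) : ℕ → α → α → Prop
  | refl (n : ℕ) (a : α) : StepsWithin f n a a
  | head {n : ℕ} {a b c : α} : f a = some b → StepsWithin f n b c → StepsWithin f (n + 1) a c

namespace StepsWithin

variable {α : Type*} {f : α → Option α}

theorem mono {n m : ℕ} {a b : α} (h : StepsWithin f n a b) (hm : n ≤ m) :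
    StepsWithin f m a b := by
  induction h generalizing m with
  | refl => exact .refl _ _
  | head h _ ih =>
    obtain ⟨m, rfl⟩ : ∃ k, m = k + 1 := ⟨m - 1, by omega⟩
    exact .head h (ih (by omega))

theorem trans {n m : ℕ} {a b c : α} (h : StepsWithin f n a b) (h' : StepsWithin f m b c) :
    StepsWithin f (n + m) a c := by
  induction h with
  | refl => exact h'.mono (by omega)
  | head h _ ih => exact (StepsWithin.head h (ih h')).mono (by omega)

theorem single {a b : α} (h : f a = some b) : StepsWithin f 1 a b := .head h (.refl 0 _)

theorem exists_iterate {n : ℕ} {a b : α} (h : StepsWithin f n a b) :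
    ∃ k ≤ n, (flip bind f)^[k] (some a) = some b := by
  induction h with
  | refl => exact ⟨0, by omega, rfl⟩
  | @head n a b c h _ ih =>
    obtain ⟨k, hk, h'⟩ := ih
    refine ⟨k + 1, by omega, ?_⟩
    rw [Function.iterate_succ_apply]
    rw [show flip bind f (some a) = some b from h, h']

theorem evalsToInTime {n : ℕ} {a b : α} (h : StepsWithin f n a b) :
    Nonempty (StateTransition.EvalsToInTime f a (some b) n) := by
  obtain ⟨k, hk, h⟩ := h.exists_iterate
  exact ⟨⟨⟨k, h⟩, hk⟩⟩

end StepsWithin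

theorem flip_bind_iterate_none {α : Type*} (f : α → Option α) (k : ℕ) :
    (flip bind f)^[k] none = none := by
  induction k with
  | zero => rfl
  | succ k ih => rw [Function.iterate_succ_apply]; exact ih

theorem stepsWithin_of_iterate {α : Type*} {f : α → Option α} :
    ∀ (k : ℕ) {a b : α}, (flip bind f)^[k] (some a) = some b → StepsWithin f k a b
  | 0, a, b, h => by
    cases h
    exact .refl _ _
  | k + 1, a, b, h => by
    rw [Function.iterate_succ_apply] at h
    cases e : f a with
    | none =>
      rw [show flip bind f (some a) = none from e, flip_bind_iterate_none] at h
      cases h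
    | some c =>
      rw [show flip bind f (some a) = some c from e] at h
      exact .head e (stepsWithin_of_iterate k h)

/-- `b` is reached from `a` by steps of `f`, and all points on the way, including `a` and `b`,
satisfy `Q`. -/
inductive RunIn {α : Type*} (f : α → Option α) (Q : α → Prop) : α → α → Prop
  | refl {a : α} : Q a → RunIn f Q a a
  | head {a b c : α} : Q a → f a = some b → RunIn f Q b c → RunIn f Q a c

namespace RunIn

variable {α : Type*} {f : α → Option α} {Q : α → Prop}

theorem trans {a b c : α} (h : RunIn f Q a b) (h' : RunIn f Q b c) : RunIn f Q a c := by
  induction h with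
  | refl => exact h'
  | head hq h _ ih => exact .head hq h (ih h')

theorem right {a b : α} (h : RunIn f Q a b) : Q b := by
  induction h with
  | refl h => exact h
  | head _ _ _ ih => exact ih

theorem imp {Q' : α → Prop} {a b : α} (h : RunIn f Q a b) (hQ : ∀ a, Q a → Q' a) :
    RunIn f Q' a b := by
  induction h with
  | refl h => exact .refl (hQ _ h)
  | head h hs _ ih => exact .head (hQ _ h) hs ih

theorem stepsWithin {a b : α} (h : RunIn f Q a b) : ∃ n, StepsWithin f n a b := by
  induction h with
  | refl => exact ⟨0, .refl _ _⟩
  | head _ h _ ih =>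
    obtain ⟨n, hn⟩ := ih
    exact ⟨n + 1, .head h hn⟩

/-- Determinism: the run is the only path out of `a`, and it stops at `b`. This turns a bound along
a run into the bound on all reachable configurations that `InPSPACE` asks for. -/
theorem forall_reaches {a b : α} (h : RunIn f Q a b) (hb : f b = none) :
    ∀ c, StateTransition.Reaches f a c → Q c := by
  induction h with
  | refl hq =>
    intro c hc
    rcases Relation.ReflTransGen.cases_head hc with rfl | ⟨d, hd, _⟩
    · exact hq
    · rw [hb] at hd; cases hd
  | head hq h _ ih =>
    intro c hc
    rcases Relation.ReflTransGen.cases_head hc with rfl | ⟨d, hd, hc⟩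
    · exact hq
    · rw [h] at hd
      cases hd
      exact ih hb c hc

end RunIn

theorem StepsWithin.runIn {α : Type*} {f : α → Option α} {Q : α → Prop} {n : ℕ} {a b : α}
    (h : StepsWithin f n a b) (hQ : ∀ c, StateTransition.Reaches f a c → Q c) :
    RunIn f Q a b := by
  induction h with
  | refl n a => exact .refl (hQ _ .refl)
  | head h _ ih => exact .head (hQ _ .refl) h (ih fun c hc => hQ c (.head h hc))

/-- A quantity that grows by at most `C` in each step. -/
theorem StepsWithin.runIn_le {α : Type*} {f : α → Option α} {s : α → ℕ} {C n : ℕ} {a b : α}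
    (hC : ∀ c d, f c = some d → s d ≤ s c + C) (h : StepsWithin f n a b) :
    RunIn f (fun c => s c ≤ s a + C * n) a b := by
  -- The bound mentions the starting point, which changes in the induction; a fixed `S` survives it.
  suffices ∀ S, s a + C * n ≤ S → RunIn f (fun c => s c ≤ S) a b from this _ le_rfl
  induction h with
  | refl n a => exact fun S hS => .refl (by omega)
  | @head n a b c h _ ih =>
    intro S hS
    have := hC _ _ h
    rw [Nat.mul_succ] at hS
    exact .head (by omega) h (ih S (by omega))

/-! ### Configurations of stack machines -/

theorem initList_eq (tm : FinTM2) (s : List (tm.Γ tm.k₀)) :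
    initList tm s = ⟨some tm.main, tm.initialState, Function.update (fun _ => []) tm.k₀ s⟩ := by
  unfold initList
  congr 1
  funext k
  by_cases h : k = tm.k₀
  · subst h
    simp
  · simp [h]

theorem haltList_eq (tm : FinTM2) (s : List (tm.Γ tm.k₁)) :
    haltList tm s = ⟨none, tm.initialState, Function.update (fun _ => []) tm.k₁ s⟩ := by
  unfold haltList
  congr 1
  funext k
  by_cases h : k = tm.k₁
  · subst h
    simp
  · simp [h]

/-- Number of stack symbols in a family of stacks. -/
def stackSize {K : Type} [Fintype K] {Γ : K → Type} (S : ∀ k, List (Γ k)) : ℕ :=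
  ∑ k, (S k).length

/-- Additive form, avoiding truncated subtraction of the replaced stack. -/
theorem stackSize_update {K : Type} [Fintype K] [DecidableEq K] {Γ : K → Type}
    (S : ∀ k, List (Γ k)) (k : K) (l : List (Γ k)) :
    stackSize (Function.update S k l) + (S k).length = stackSize S + l.length := by
  unfold stackSize
  rw [← Finset.add_sum_erase _ _ (Finset.mem_univ k),
    ← Finset.add_sum_erase _ (fun k => (S k).length) (Finset.mem_univ k)]
  have : ∑ x ∈ Finset.univ.erase k, (Function.update S k l x).length =
      ∑ x ∈ Finset.univ.erase k, (S x).length :=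
    Finset.sum_congr rfl fun x hx => by rw [Function.update_of_ne (Finset.ne_of_mem_erase hx)]
  rw [this, Function.update_self]
  omega

theorem stackSize_empty {K : Type} [Fintype K] {Γ : K → Type} :
    stackSize (fun k => ([] : List (Γ k))) = 0 := by
  simp [stackSize]

theorem stackSize_single {K : Type} [Fintype K] [DecidableEq K] {Γ : K → Type}
    (k : K) (l : List (Γ k)) :
    stackSize (Function.update (fun k => ([] : List (Γ k))) k l) = l.length := by
  have := stackSize_update (fun k => ([] : List (Γ k))) k l
  rw [stackSize_empty] at this
  simpa using this

/-- The largest number of symbols that a statement can push. -/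
def pushes {K : Type} {Γ : K → Type} {Λ σ : Type} : TM2.Stmt Γ Λ σ → ℕ
  | .push _ _ q => pushes q + 1
  | .peek _ _ q => pushes q
  | .pop _ _ q => pushes q
  | .load _ q => pushes q
  | .branch _ q₁ q₂ => max (pushes q₁) (pushes q₂)
  | .goto _ => 0
  | .halt => 0

theorem stackSize_stepAux {K : Type} [Fintype K] [DecidableEq K] {Γ : K → Type} {Λ σ : Type}
    (q : TM2.Stmt Γ Λ σ) (v : σ) (S : ∀ k, List (Γ k)) :
    stackSize (TM2.stepAux q v S).stk ≤ stackSize S + pushes q := by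
  induction q generalizing v S with
  | push k f q ih =>
    have h := stackSize_update S k (f v :: S k)
    have := ih v (Function.update S k (f v :: S k))
    simp only [TM2.stepAux, pushes, List.length_cons] at *
    omega
  | peek k f q ih => exact ih _ _
  | pop k f q ih =>
    have h := stackSize_update S k (S k).tail
    have := ih (f v (S k).head?) (Function.update S k (S k).tail)
    simp only [TM2.stepAux, pushes, List.length_tail] at *
    omega
  | load f q ih => exact ih _ _
  | branch f q₁ q₂ ih₁ ih₂ =>
    have h₁ := ih₁ v S
    have h₂ := ih₂ v S
    simp only [TM2.stepAux, pushes]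
    cases f v <;> simp only [cond_true, cond_false] <;> omega
  | goto f => simp [TM2.stepAux]
  | halt => simp [TM2.stepAux]

theorem cfgSpace_eq (M : FinTM2) (c : M.Cfg) :
    cfgSpace M c = @stackSize _ M.kFin _ (TM2.Cfg.stk c) := rfl

/-- A step executes the statement of a single label, so the sum of `pushes` over the finitely many
labels bounds the growth in any step. -/
theorem exists_cfgSpace_step_le (M : FinTM2) :
    ∃ C, ∀ c d : M.Cfg, M.step c = some d → cfgSpace M d ≤ cfgSpace M c + C := by
  let := M.kFin
  let := M.ΛFin
  refine ⟨∑ l, pushes (M.m l), ?_⟩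
  rintro ⟨l | l, v, S⟩ d h
  · cases h
  · obtain rfl : TM2.stepAux (M.m l) v S = d := Option.some.inj h
    have h1 := stackSize_stepAux (M.m l) v S
    have h2 := Finset.single_le_sum (f := fun l => pushes (M.m l)) (fun _ _ => Nat.zero_le _)
      (Finset.mem_univ l)
    exact h1.trans (Nat.add_le_add_left h2 _)

theorem cfgSpace_initList (M : FinTM2) (s : List (M.Γ M.k₀)) :
    cfgSpace M (initList M s) = s.length := by
  let := M.kFin
  rw [cfgSpace_eq, initList_eq]
  exact stackSize_single _ _

theorem cfgSpace_haltList (M : FinTM2) (s : List (M.Γ M.k₁)) :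
    cfgSpace M (haltList M s) = s.length := by
  let := M.kFin
  rw [cfgSpace_eq, haltList_eq]
  exact stackSize_single _ _

theorem polynomial_eval_mono (p : Polynomial ℕ) {m n : ℕ} (h : m ≤ n) : p.eval m ≤ p.eval n := by
  rw [Polynomial.eval_eq_sum, Polynomial.eval_eq_sum]
  exact Finset.sum_le_sum fun i _ => Nat.mul_le_mul_left _ (Nat.pow_le_pow_left h i)

/-- A polynomial-time machine uses polynomial space; so its output has polynomial length. -/
theorem polySpace_of_polyTime {α β Γ₁ Γ₂ : Type} {ea : α → List Γ₁} {eb : β → List Γ₂}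
    {f : α → β} (h : TM2ComputableInPolyTime ea eb f) :
    ∃ p : Polynomial ℕ, ∀ a,
      RunIn h.tm.step (fun c => cfgSpace h.tm c ≤ p.eval (ea a).length)
        (initList h.tm ((ea a).map h.inputAlphabet.symm))
        (haltList h.tm ((eb (f a)).map h.outputAlphabet.symm)) ∧
      (eb (f a)).length ≤ p.eval (ea a).length := by
  obtain ⟨C, hC⟩ := exists_cfgSpace_step_le h.tm
  -- The length of the input plus at most `C` new symbols per step.
  refine ⟨Polynomial.X + Polynomial.C C * h.time, fun a => ?_⟩
  have ho := h.outputsFun a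
  have h1 := (stepsWithin_of_iterate _ ho.evals_in_steps).mono ho.steps_le_m
  have h2 := StepsWithin.runIn_le hC h1
  rw [cfgSpace_initList, List.length_map] at h2
  have h3 : RunIn h.tm.step
      (fun c => cfgSpace h.tm c ≤ (Polynomial.X + Polynomial.C C * h.time).eval (ea a).length)
        (initList h.tm ((ea a).map h.inputAlphabet.symm))
        (haltList h.tm ((eb (f a)).map h.outputAlphabet.symm)) := by
    simpa using h2
  refine ⟨h3, ?_⟩
  have h5 := h3.right
  rwa [cfgSpace_haltList, List.length_map] at h5

/-! ### Polynomial space is closed under parallel queries -/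

instance finTM2StackFintype (tm : FinTM2) : Fintype tm.K := tm.kFin

instance finTM2LabelFintype (tm : FinTM2) : Fintype tm.Λ := tm.ΛFin

instance finTM2StateFintype (tm : FinTM2) : Fintype tm.σ := tm.σFin

instance finTM2InputFintype (tm : FinTM2) : Fintype (tm.Γ tm.k₀) := tm.Γk₀Fin

open Classical in
/-- Push the symbol `f v`, if there is one. -/
noncomputable def pushSome {K : Type} {Γ : K → Type} {Λ σ : Type} (k : K) (f : σ → Option (Γ k))
    (q : TM2.Stmt Γ Λ σ) : TM2.Stmt Γ Λ σ :=
  -- The default symbol only makes the pushed function total; in the runs considered below, `f v` is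
  -- always a `some` when this push is executed.
  if h : Nonempty (Γ k) then .push k (fun v => (f v).getD h.some) q else q

theorem stepAux_pushSome {K : Type} [DecidableEq K] {Γ : K → Type} {Λ σ : Type} {k : K}
    {f : σ → Option (Γ k)} {q : TM2.Stmt Γ Λ σ} {v : σ} {S : ∀ k, List (Γ k)} {a : Γ k}
    (h : f v = some a) :
    TM2.stepAux (pushSome k f q) v S = TM2.stepAux q v (Function.update S k (a :: S k)) := by
  have : Nonempty (Γ k) := ⟨a⟩
  simp [pushSome, this, h]

namespace Host

/-- The three machines run in turn: the first writes the queries, the second answers each of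
them, the third decides from the answers. -/
inductive Stage
  | ask | solve | judge
  deriving DecidableEq

instance : Fintype Stage :=
  ⟨{.ask, .solve, .judge}, by intro x; cases x <;> simp⟩

/-- Auxiliary stacks. -/
inductive Aux
  | temp | input | query | bits
  deriving DecidableEq

instance : Fintype Aux :=
  ⟨{.temp, .input, .query, .bits}, by intro x; cases x <;> simp⟩

/-- Labels of the host. -/
inductive Lab
  | unload | reload | split | feed | collect | putBits | putInput | finish
  deriving DecidableEq

instance : Fintype Lab :=
  ⟨{.unload, .reload, .split, .feed, .collect, .putBits, .putInput, .finish},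
    by intro x; cases x <;> simp⟩

variable (M : Stage → FinTM2)

/-- Symbols of the auxiliary stacks. -/
abbrev AuxSym : Aux → Type
  | .temp => (M .ask).Γ (M .ask).k₀
  | .input => (M .judge).Γ (M .judge).k₀
  | .query => (M .solve).Γ (M .solve).k₀
  | .bits => (M .judge).Γ (M .judge).k₀

/-- Stacks of the host. -/
abbrev Stk := Aux ⊕ (Σ j, (M j).K)

/-- Symbols on the stacks of the host. -/
abbrev Sym : Stk M → Type
  | .inl a => AuxSym M a
  | .inr ⟨j, k⟩ => (M j).Γ k

/-- Program labels of the host. -/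
abbrev Label := Lab ⊕ (Σ j, (M j).Λ)

/-- Registers of the host. -/
abbrev Reg := Option ((M .ask).Γ (M .ask).k₀) × Option (Option ((M .solve).Γ (M .solve).k₀)) ×
  Option ((M .judge).Γ (M .judge).k₀)

/-- Internal states of the host. -/
abbrev St := Reg M × (∀ j, (M j).σ)

/-- Where the host continues when a guest halts. -/
def ret : Stage → Lab
  | .ask => .split
  | .solve => .collect
  | .judge => .finish

/-- A guest's statement as a statement of the host. -/
def lift (j : Stage) : TM2.Stmt (M j).Γ (M j).Λ (M j).σ → TM2.Stmt (Sym M) (Label M) (St M)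
  | .push k f q => .push (.inr ⟨j, k⟩) (fun v => f (v.2 j)) (lift j q)
  | .peek k f q =>
    .peek (.inr ⟨j, k⟩) (fun v s => (v.1, Function.update v.2 j (f (v.2 j) s))) (lift j q)
  | .pop k f q =>
    .pop (.inr ⟨j, k⟩) (fun v s => (v.1, Function.update v.2 j (f (v.2 j) s))) (lift j q)
  | .load f q => .load (fun v => (v.1, Function.update v.2 j (f (v.2 j)))) (lift j q)
  | .branch f q₁ q₂ => .branch (fun v => f (v.2 j)) (lift j q₁) (lift j q₂)
  | .goto f => .goto (fun v => .inr ⟨j, f (v.2 j)⟩)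
  | .halt => .goto (fun _ => .inl (ret j))

variable (c : (M .ask).Γ (M .ask).k₁ ≃ Option ((M .solve).Γ (M .solve).k₀))
  (i : (M .ask).Γ (M .ask).k₀ → (M .judge).Γ (M .judge).k₀)
  (o : (M .solve).Γ (M .solve).k₁ → (M .judge).Γ (M .judge).k₀)

/-- The host's own code. -/
noncomputable def code : Lab → TM2.Stmt (Sym M) (Label M) (St M)
  -- The input is moved to `temp`, to be put back by `reload`, and a copy translated by `i` waits on
  -- `input` for the judge.
  | .unload => .pop (.inr ⟨.ask, (M .ask).k₀⟩) (fun v s => ((s, v.1.2), v.2)) <|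
      .branch (fun v => v.1.1.isSome)
        (pushSome (.inl .temp) (fun v => v.1.1) <|
          pushSome (.inl .input) (fun v => v.1.1.map i) <| .goto fun _ => .inl .unload)
        (.goto fun _ => .inl .reload)
  | .reload => .pop (.inl .temp) (fun v s => ((s, v.1.2), v.2)) <|
      .branch (fun v => v.1.1.isSome)
        (pushSome (.inr ⟨.ask, (M .ask).k₀⟩) (fun v => v.1.1) <| .goto fun _ => .inl .reload)
        (.goto fun _ => .inr ⟨.ask, (M .ask).main⟩)
  -- The register tells apart an empty stack (`none`: no query left), a separator (`some none`:
  -- query complete) and a symbol of a query.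
  | .split => .pop (.inr ⟨.ask, (M .ask).k₁⟩)
        (fun v s => ((v.1.1, Option.map c s, v.1.2.2), v.2)) <|
      .branch (fun v => v.1.2.1.isSome)
        (.branch (fun v => v.1.2.1.join.isSome)
          (pushSome (.inl .query) (fun v => v.1.2.1.join) <| .goto fun _ => .inl .split)
          (.goto fun _ => .inl .feed))
        (.goto fun _ => .inl .putBits)
  -- `split` has left the query reversed; moving it once more restores its order.
  | .feed => .pop (.inl .query) (fun v s => ((v.1.1, Option.map some s, v.1.2.2), v.2)) <|
      .branch (fun v => v.1.2.1.isSome)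
        (pushSome (.inr ⟨.solve, (M .solve).k₀⟩) (fun v => v.1.2.1.join) <|
          .goto fun _ => .inl .feed)
        (.goto fun _ => .inr ⟨.solve, (M .solve).main⟩)
  | .collect => .pop (.inr ⟨.solve, (M .solve).k₁⟩)
        (fun v s => ((v.1.1, v.1.2.1, Option.map o s), v.2)) <|
      pushSome (.inl .bits) (fun v => v.1.2.2) <| .goto fun _ => .inl .split
  -- The answers go below the input, since the top of a stack is the first symbol of the word.
  | .putBits => .pop (.inl .bits) (fun v s => ((v.1.1, v.1.2.1, s), v.2)) <|
      .branch (fun v => v.1.2.2.isSome)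
        (pushSome (.inr ⟨.judge, (M .judge).k₀⟩) (fun v => v.1.2.2) <|
          .goto fun _ => .inl .putBits)
        (.goto fun _ => .inl .putInput)
  | .putInput => .pop (.inl .input) (fun v s => ((v.1.1, v.1.2.1, s), v.2)) <|
      .branch (fun v => v.1.2.2.isSome)
        (pushSome (.inr ⟨.judge, (M .judge).k₀⟩) (fun v => v.1.2.2) <|
          .goto fun _ => .inl .putInput)
        (.goto fun _ => .inr ⟨.judge, (M .judge).main⟩)
  | .finish => .halt

/-- The whole program. -/
noncomputable def prog : Label M → TM2.Stmt (Sym M) (Label M) (St M)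
  | .inl l => code M c i o l
  | .inr ⟨j, l⟩ => lift M j ((M j).m l)

/-- The host machine. -/
noncomputable def machine : FinTM2 where
  K := Stk M
  k₀ := .inr ⟨.ask, (M .ask).k₀⟩
  k₁ := .inr ⟨.judge, (M .judge).k₁⟩
  Γ := Sym M
  Λ := Label M
  main := .inl .unload
  σ := St M
  initialState := ((none, none, none), fun j => (M j).initialState)
  Γk₀Fin := finTM2InputFintype (M .ask)
  m := prog M c i o

/-- Stack contents of the host. -/
def join (t : List (AuxSym M .temp)) (x : List (AuxSym M .input)) (u : List (AuxSym M .query))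
    (b : List (AuxSym M .bits)) (g : ∀ j k, List ((M j).Γ k)) : ∀ k, List (Sym M k)
  | .inl .temp => t
  | .inl .input => x
  | .inl .query => u
  | .inl .bits => b
  | .inr ⟨j, k⟩ => g j k

variable {M}

theorem update_join_temp (t x u b g) (t' : List (AuxSym M .temp)) :
    Function.update (join M t x u b g) (.inl .temp) t' = join M t' x u b g := by
  funext k
  rcases k with (_ | _ | _ | _) | ⟨j, k⟩ <;> rfl

theorem update_join_input (t x u b g) (x' : List (AuxSym M .input)) :
    Function.update (join M t x u b g) (.inl .input) x' = join M t x' u b g := by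
  funext k
  rcases k with (_ | _ | _ | _) | ⟨j, k⟩ <;> rfl

theorem update_join_query (t x u b g) (u' : List (AuxSym M .query)) :
    Function.update (join M t x u b g) (.inl .query) u' = join M t x u' b g := by
  funext k
  rcases k with (_ | _ | _ | _) | ⟨j, k⟩ <;> rfl

theorem update_join_bits (t x u b g) (b' : List (AuxSym M .bits)) :
    Function.update (join M t x u b g) (.inl .bits) b' = join M t x u b' g := by
  funext k
  rcases k with (_ | _ | _ | _) | ⟨j, k⟩ <;> rfl

theorem update_join_guest (t x u b) (g : ∀ j k, List ((M j).Γ k)) (j : Stage) (k : (M j).K)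
    (l : List ((M j).Γ k)) :
    Function.update (join M t x u b g) (.inr ⟨j, k⟩) l =
      join M t x u b (Function.update g j (Function.update (g j) k l)) := by
  funext k'
  rcases k' with (_ | _ | _ | _) | ⟨j', k'⟩
  · rfl
  · rfl
  · rfl
  · rfl
  · by_cases h : j' = j
    · subst h
      by_cases h : k' = k
      · subst h
        simp [join]
      · rw [Function.update_of_ne (by simpa using h)]
        simp [join, h]
    · rw [Function.update_of_ne (by
        intro h'
        cases h'
        exact h rfl)]
      simp [join, h]

theorem stackSize_join (t x u b) (g : ∀ j k, List ((M j).Γ k)) :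
    stackSize (join M t x u b g) =
      t.length + x.length + u.length + b.length + ∑ j, stackSize (g j) := by
  unfold stackSize
  rw [Fintype.sum_sum_type, Fintype.sum_sigma]
  congr 1
  show ∑ a ∈ {Aux.temp, Aux.input, Aux.query, Aux.bits}, _ = _
  simp [join]
  ring

/-- The configuration of the host while guest `j` is in configuration `d`. -/
def embed (j : Stage) (r : Reg M) (v : ∀ j, (M j).σ)
    (t : List (AuxSym M .temp)) (x : List (AuxSym M .input)) (u : List (AuxSym M .query))
    (b : List (AuxSym M .bits)) (g : ∀ j k, List ((M j).Γ k))
    (d : TM2.Cfg (M j).Γ (M j).Λ (M j).σ) : TM2.Cfg (Sym M) (Label M) (St M) :=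
  ⟨some (d.l.elim (.inl (ret j)) fun l => .inr ⟨j, l⟩), (r, Function.update v j d.var),
    join M t x u b (Function.update g j d.stk)⟩

/-- A lifted statement touches only the stacks and the state of guest `j`, and a halt becomes the
jump to `ret j`, which is how `embed` renders a guest without label. So one host step simulates one
guest step. -/
theorem stepAux_lift (j : Stage) (r : Reg M) (v : ∀ j, (M j).σ)
    (t : List (AuxSym M .temp)) (x : List (AuxSym M .input)) (u : List (AuxSym M .query))
    (b : List (AuxSym M .bits))
    (g : ∀ j k, List ((M j).Γ k)) (q : TM2.Stmt (M j).Γ (M j).Λ (M j).σ) (w : (M j).σ)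
    (S : ∀ k, List ((M j).Γ k)) :
    TM2.stepAux (lift M j q) (r, Function.update v j w) (join M t x u b (Function.update g j S)) =
      embed j r v t x u b g (TM2.stepAux q w S) := by
  induction q generalizing w S with
  | push k f q ih =>
    rw [lift, TM2.stepAux, TM2.stepAux, update_join_guest, ← ih]
    simp [join]
  | peek k f q ih =>
    rw [lift, TM2.stepAux, TM2.stepAux, ← ih]
    simp [join]
  | pop k f q ih =>
    rw [lift, TM2.stepAux, TM2.stepAux, update_join_guest, ← ih]
    simp [join]
  | load f q ih =>
    rw [lift, TM2.stepAux, TM2.stepAux, ← ih]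
    simp
  | branch f q₁ q₂ ih₁ ih₂ =>
    rw [lift, TM2.stepAux, TM2.stepAux, ih₁, ih₂]
    simp only [Function.update_self]
    cases f w <;> rfl
  | goto f => simp [lift, embed]
  | halt => simp [lift, embed]

variable {c i o}

/-- The stacks outside guest `j` stay fixed during its run, so their size is a constant added to the
guest's own bound. -/
theorem runIn_embed (j : Stage) (r : Reg M) (v : ∀ j, (M j).σ)
    (t : List (AuxSym M .temp)) (x : List (AuxSym M .input)) (u : List (AuxSym M .query))
    (b : List (AuxSym M .bits))
    (g : ∀ j k, List ((M j).Γ k)) {s S : ℕ} {d d' : (M j).Cfg}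
    (h : RunIn (M j).step (fun d => cfgSpace (M j) d ≤ s) d d')
    (hS : t.length + x.length + u.length + b.length + s +
      ∑ j' ∈ Finset.univ.erase j, stackSize (g j') ≤ S) :
    RunIn (TM2.step (prog M c i o)) (fun d => stackSize d.stk ≤ S)
      (embed j r v t x u b g d) (embed j r v t x u b g d') := by
  have key : ∀ d : (M j).Cfg, cfgSpace (M j) d ≤ s →
      stackSize (embed j r v t x u b g d).stk ≤ S := by
    intro d hd
    show stackSize (join M t x u b (Function.update g j d.stk)) ≤ S
    rw [stackSize_join, ← Finset.add_sum_erase _ _ (Finset.mem_univ j)]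
    have : ∑ x ∈ Finset.univ.erase j, stackSize (Function.update g j d.stk x) =
        ∑ j' ∈ Finset.univ.erase j, stackSize (g j') :=
      Finset.sum_congr rfl fun x hx => by rw [Function.update_of_ne (Finset.ne_of_mem_erase hx)]
    rw [this, Function.update_self]
    have hd' : stackSize d.stk ≤ s := hd
    omega
  induction h with
  | refl hq => exact .refl (key _ hq)
  | @head a b' c' hq hs _ ih =>
    refine .head (key _ hq) ?_ ih
    obtain ⟨l | l, w, T⟩ := a
    · cases hs
    · obtain rfl : TM2.stepAux ((M j).m l) w T = b' := Option.some.inj hs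
      exact congrArg some (stepAux_lift j r v t x u b g ((M j).m l) w T)

/-- Stacks of the three guests. -/
def guests (a : ∀ k, List ((M .ask).Γ k)) (s : ∀ k, List ((M .solve).Γ k))
    (d : ∀ k, List ((M .judge).Γ k)) : ∀ j k, List ((M j).Γ k)
  | .ask => a
  | .solve => s
  | .judge => d

theorem update_guests_ask (a s d) (a' : ∀ k, List ((M .ask).Γ k)) :
    Function.update (guests a s d) .ask a' = guests a' s d := by
  funext j
  cases j <;> rfl

theorem update_guests_solve (a s d) (s' : ∀ k, List ((M .solve).Γ k)) :
    Function.update (guests a s d) .solve s' = guests a s' d := by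
  funext j
  cases j <;> rfl

theorem update_guests_judge (a s d) (d' : ∀ k, List ((M .judge).Γ k)) :
    Function.update (guests a s d) .judge d' = guests a s d' := by
  funext j
  cases j <;> rfl

/-- All stacks but one are empty. -/
def only {tm : FinTM2} (k : tm.K) (l : List (tm.Γ k)) : ∀ k, List (tm.Γ k) :=
  Function.update (fun _ => []) k l

theorem update_only {tm : FinTM2} (k : tm.K) (l l' : List (tm.Γ k)) :
    Function.update (only k l) k l' = only k l' := Function.update_idem _ _ _

theorem only_self {tm : FinTM2} (k : tm.K) (l : List (tm.Γ k)) : only k l k = l :=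
  Function.update_self _ _ _

theorem only_nil {tm : FinTM2} (k k' : tm.K) : only k ([] : List (tm.Γ k)) = only k' [] := by
  simp [only, Function.update_eq_self]

theorem stackSize_only {tm : FinTM2} (k : tm.K) (l : List (tm.Γ k)) :
    stackSize (only k l) = l.length := stackSize_single _ _

/-- Configurations of the host between runs of the guests. -/
def cfg (l : Label M) (r : Reg M) (t : List (AuxSym M .temp)) (x : List (AuxSym M .input))
    (u : List (AuxSym M .query)) (b : List (AuxSym M .bits)) (a : ∀ k, List ((M .ask).Γ k))
    (s : ∀ k, List ((M .solve).Γ k)) (d : ∀ k, List ((M .judge).Γ k)) :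
    TM2.Cfg (Sym M) (Label M) (St M) :=
  ⟨some l, (r, fun j => (M j).initialState), join M t x u b (guests a s d)⟩

theorem size_cfg (l r t x u b a s d) :
    stackSize (cfg (M := M) l r t x u b a s d).stk =
      t.length + x.length + u.length + b.length +
        (stackSize a + stackSize s + stackSize d) := by
  show stackSize (join M t x u b (guests a s d)) = _
  rw [stackSize_join]
  congr 1
  show ∑ a ∈ {Stage.ask, Stage.solve, Stage.judge}, _ = _
  simp [guests]
  ring

variable (M) in
/-- Nothing on the stacks of a guest. -/
abbrev clear (j : Stage) : ∀ k, List ((M j).Γ k) := only (M j).k₀ []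

/-! ### Loops of the host and complete runs of its guests -/

theorem run_unload (r c' d) {S : ℕ} : ∀ (w t : List ((M .ask).Γ (M .ask).k₀)) (x),
    -- Each popped symbol is pushed twice.
    2 * w.length + t.length + x.length ≤ S →
    RunIn (TM2.step (prog M c i o)) (fun d => stackSize d.stk ≤ S)
      (cfg (.inl .unload) (r, c', d) t x [] [] (only (M .ask).k₀ w) (clear M _) (clear M _))
      (cfg (.inl .reload) (none, c', d) (w.reverse ++ t) ((w.map i).reverse ++ x) [] []
        (clear M _) (clear M _) (clear M _)) := by
  intro w
  induction w generalizing r with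
  | nil =>
    intro t x hS
    refine .head ?_ ?_ (.refl ?_)
    · simpa [size_cfg, stackSize_only] using hS
    · simp [cfg, prog, code, join, guests, only_self, update_join_guest, update_guests_ask,
        update_only]
    · simpa [size_cfg, stackSize_only] using hS
  | cons y w ih =>
    intro t x hS
    rw [List.length_cons] at hS
    refine .head (b := cfg (.inl .unload) (some y, c', d) (y :: t) (i y :: x) [] []
      (only (M .ask).k₀ w) (clear M _) (clear M _)) ?_ ?_ ?_
    · simp only [size_cfg, stackSize_only, List.length_cons, List.length_nil]
      omega
    · simp [cfg, prog, code, join, guests, only_self, stepAux_pushSome, update_join_guest,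
        update_join_temp, update_join_input, update_guests_ask, update_only]
    · have := ih (some y) (y :: t) (i y :: x) (by simp only [List.length_cons]; omega)
      simpa using this

theorem run_reload (r c' d) {S : ℕ} (x) : ∀ (t w : List ((M .ask).Γ (M .ask).k₀)),
    w.length + t.length + x.length ≤ S →
    RunIn (TM2.step (prog M c i o)) (fun d => stackSize d.stk ≤ S)
      (cfg (.inl .reload) (r, c', d) t x [] [] (only (M .ask).k₀ w) (clear M _) (clear M _))
      (cfg (.inr ⟨.ask, (M .ask).main⟩) (none, c', d) [] x [] []
        (only (M .ask).k₀ (t.reverse ++ w)) (clear M _) (clear M _)) := by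
  intro t
  induction t generalizing r with
  | nil =>
    intro w hS
    refine .head ?_ ?_ (.refl ?_)
    · simp only [size_cfg, stackSize_only, List.length_nil] at hS ⊢
      omega
    · simp [cfg, prog, code, join, update_join_temp]
    · simp only [size_cfg, stackSize_only, List.length_nil, List.reverse_nil,
        List.nil_append] at hS ⊢
      omega
  | cons y t ih =>
    intro w hS
    rw [List.length_cons] at hS
    refine .head (b := cfg (.inl .reload) (some y, c', d) t x [] []
      (only (M .ask).k₀ (y :: w)) (clear M _) (clear M _)) ?_ ?_ ?_
    · simp only [size_cfg, stackSize_only, List.length_cons, List.length_nil]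
      omega
    · simp [cfg, prog, code, join, guests, only_self, stepAux_pushSome, update_join_guest,
        update_join_temp, update_guests_ask, update_only]
    · have := ih (some y) (y :: w) (by simp only [List.length_cons]; omega)
      simpa using this

/-- Reading a query. -/
theorem run_split (r d) {S : ℕ} (x b) (l : List ((M .ask).Γ (M .ask).k₁)) :
    ∀ (w u : List ((M .solve).Γ (M .solve).k₀)) (c'),
    x.length + u.length + b.length + l.length + w.length + 1 ≤ S →
    RunIn (TM2.step (prog M c i o)) (fun d => stackSize d.stk ≤ S)
      (cfg (.inl .split) (r, c', d) [] x u b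
        (only (M .ask).k₁ (w.map (fun a => c.symm (some a)) ++ c.symm none :: l))
        (clear M _) (clear M _))
      (cfg (.inl .feed) (r, some none, d) [] x (w.reverse ++ u) b
        (only (M .ask).k₁ l) (clear M _) (clear M _)) := by
  intro w
  induction w with
  | nil =>
    intro u c' hS
    refine .head ?_ ?_ (.refl ?_)
    · simp only [size_cfg, stackSize_only, List.length_nil, List.length_append, List.map_nil,
        List.length_cons] at hS ⊢
      omega
    · simp [cfg, prog, code, join, guests, only_self, update_join_guest, update_guests_ask,
        update_only]
    · simp only [size_cfg, stackSize_only, List.length_nil, List.reverse_nil,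
        List.nil_append] at hS ⊢
      omega
  | cons y w ih =>
    intro u c' hS
    rw [List.length_cons] at hS
    refine .head (b := cfg (.inl .split) (r, some (some y), d) [] x (y :: u) b
      (only (M .ask).k₁ (w.map (fun a => c.symm (some a)) ++ c.symm none :: l))
      (clear M _) (clear M _)) ?_ ?_ ?_
    · simp only [size_cfg, stackSize_only, List.length_cons, List.length_nil, List.length_append,
        List.length_map]
      omega
    · simp [cfg, prog, code, join, guests, only_self, stepAux_pushSome, update_join_guest,
        update_join_query, update_guests_ask, update_only]
    · have := ih (y :: u) (some (some y)) (by simp only [List.length_cons]; omega)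
      simpa using this

/-- Handing a query over. -/
theorem run_feed (r d) {S : ℕ} (x b) (l : List ((M .ask).Γ (M .ask).k₁)) :
    ∀ (u w : List ((M .solve).Γ (M .solve).k₀)) (c'),
    x.length + u.length + b.length + l.length + w.length ≤ S →
    RunIn (TM2.step (prog M c i o)) (fun d => stackSize d.stk ≤ S)
      (cfg (.inl .feed) (r, c', d) [] x u b
        (only (M .ask).k₁ l) (only (M .solve).k₀ w) (clear M _))
      (cfg (.inr ⟨.solve, (M .solve).main⟩) (r, none, d) [] x [] b
        (only (M .ask).k₁ l) (only (M .solve).k₀ (u.reverse ++ w)) (clear M _)) := by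
  intro u
  induction u with
  | nil =>
    intro w c' hS
    refine .head ?_ ?_ (.refl ?_)
    · simp only [size_cfg, stackSize_only, List.length_nil] at hS ⊢
      omega
    · simp [cfg, prog, code, join, update_join_query]
    · simp only [size_cfg, stackSize_only, List.length_nil, List.reverse_nil,
        List.nil_append] at hS ⊢
      omega
  | cons y u ih =>
    intro w c' hS
    rw [List.length_cons] at hS
    refine .head (b := cfg (.inl .feed) (r, some (some y), d) [] x u b
      (only (M .ask).k₁ l) (only (M .solve).k₀ (y :: w)) (clear M _)) ?_ ?_ ?_
    · simp only [size_cfg, stackSize_only, List.length_cons, List.length_nil]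
      omega
    · simp [cfg, prog, code, join, guests, only_self, stepAux_pushSome, update_join_guest,
        update_join_query, update_guests_solve, update_only]
    · have := ih (y :: w) (some (some y)) (by simp only [List.length_cons]; omega)
      simpa using this

theorem run_putBits (r c') {S : ℕ} (x) :
    ∀ (b w : List ((M .judge).Γ (M .judge).k₀)) (d),
    x.length + b.length + w.length ≤ S →
    RunIn (TM2.step (prog M c i o)) (fun d => stackSize d.stk ≤ S)
      (cfg (.inl .putBits) (r, c', d) [] x [] b
        (clear M _) (clear M _) (only (M .judge).k₀ w))
      (cfg (.inl .putInput) (r, c', none) [] x [] []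
        (clear M _) (clear M _) (only (M .judge).k₀ (b.reverse ++ w))) := by
  intro b
  induction b with
  | nil =>
    intro w d hS
    refine .head ?_ ?_ (.refl ?_)
    · simp only [size_cfg, stackSize_only, List.length_nil] at hS ⊢
      omega
    · simp [cfg, prog, code, join, update_join_bits]
    · simp only [size_cfg, stackSize_only, List.length_nil, List.reverse_nil,
        List.nil_append] at hS ⊢
      omega
  | cons y b ih =>
    intro w d hS
    rw [List.length_cons] at hS
    refine .head (b := cfg (.inl .putBits) (r, c', some y) [] x [] b
      (clear M _) (clear M _) (only (M .judge).k₀ (y :: w))) ?_ ?_ ?_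
    · simp only [size_cfg, stackSize_only, List.length_cons, List.length_nil]
      omega
    · simp [cfg, prog, code, join, guests, only_self, stepAux_pushSome, update_join_guest,
        update_join_bits, update_guests_judge, update_only]
    · have := ih (y :: w) (some y) (by simp only [List.length_cons]; omega)
      simpa using this

theorem run_putInput (r c') {S : ℕ} :
    ∀ (x w : List ((M .judge).Γ (M .judge).k₀)) (d),
    x.length + w.length ≤ S →
    RunIn (TM2.step (prog M c i o)) (fun d => stackSize d.stk ≤ S)
      (cfg (.inl .putInput) (r, c', d) [] x [] []
        (clear M _) (clear M _) (only (M .judge).k₀ w))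
      (cfg (.inr ⟨.judge, (M .judge).main⟩) (r, c', none) [] [] [] []
        (clear M _) (clear M _) (only (M .judge).k₀ (x.reverse ++ w))) := by
  intro x
  induction x with
  | nil =>
    intro w d hS
    refine .head ?_ ?_ (.refl ?_)
    · simp only [size_cfg, stackSize_only, List.length_nil] at hS ⊢
      omega
    · simp [cfg, prog, code, join, update_join_input]
    · simp only [size_cfg, stackSize_only, List.length_nil, List.reverse_nil,
        List.nil_append] at hS ⊢
      omega
  | cons y x ih =>
    intro w d hS
    rw [List.length_cons] at hS
    refine .head (b := cfg (.inl .putInput) (r, c', some y) [] x [] []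
      (clear M _) (clear M _) (only (M .judge).k₀ (y :: w))) ?_ ?_ ?_
    · simp only [size_cfg, stackSize_only, List.length_cons, List.length_nil]
      omega
    · simp [cfg, prog, code, join, guests, only_self, stepAux_pushSome, update_join_guest,
        update_join_input, update_guests_judge, update_only]
    · have := ih (y :: w) (some y) (by simp only [List.length_cons]; omega)
      simpa using this

/-- A complete run of a guest. -/
theorem run_guest (j : Stage) (r : Reg M) (x b) (g : ∀ j k, List ((M j).Γ k)) {s S : ℕ} {l l'}
    (h : RunIn (M j).step (fun d => cfgSpace (M j) d ≤ s) (initList (M j) l) (haltList (M j) l'))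
    (hS : x.length + b.length + s + ∑ j' ∈ Finset.univ.erase j, stackSize (g j') ≤ S) :
    RunIn (TM2.step (prog M c i o)) (fun d => stackSize d.stk ≤ S)
      ⟨some (.inr ⟨j, (M j).main⟩), (r, fun j => (M j).initialState),
        join M [] x [] b (Function.update g j (only (M j).k₀ l))⟩
      ⟨some (.inl (ret j)), (r, fun j => (M j).initialState),
        join M [] x [] b (Function.update g j (only (M j).k₁ l'))⟩ := by
  have := runIn_embed (c := c) (i := i) (o := o) j r (fun j => (M j).initialState) [] x [] b g h
    (by simpa using hS)
  -- Both ends carry the guest's initial state, so the host's family of states is the same before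
  -- and after, and the guest can be started again.
  rw [initList_eq, haltList_eq] at this
  simpa [embed, only] using this

theorem run_ask (r : Reg M) (x) {s S : ℕ} {l l'}
    (h : RunIn (M .ask).step (fun d => cfgSpace (M .ask) d ≤ s)
      (initList (M .ask) l) (haltList (M .ask) l'))
    (hS : x.length + s ≤ S) :
    RunIn (TM2.step (prog M c i o)) (fun d => stackSize d.stk ≤ S)
      (cfg (.inr ⟨.ask, (M .ask).main⟩) r [] x [] [] (only (M .ask).k₀ l)
        (clear M _) (clear M _))
      (cfg (.inl .split) r [] x [] [] (only (M .ask).k₁ l') (clear M _) (clear M _)) := by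
  have := run_guest (c := c) (i := i) (o := o) .ask r x []
    (guests (clear M _) (clear M _) (clear M _)) (S := S) h (by
      have : Finset.univ.erase Stage.ask = {.solve, .judge} := by decide
      rw [this]
      simpa [guests, stackSize_only] using hS)
  simp only [update_guests_ask] at this
  exact this

theorem run_solve (r : Reg M) (x b q) {s S : ℕ} {l l'}
    (h : RunIn (M .solve).step (fun d => cfgSpace (M .solve) d ≤ s)
      (initList (M .solve) l) (haltList (M .solve) l'))
    (hS : x.length + b.length + q.length + s ≤ S) :
    RunIn (TM2.step (prog M c i o)) (fun d => stackSize d.stk ≤ S)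
      (cfg (.inr ⟨.solve, (M .solve).main⟩) r [] x [] b (only (M .ask).k₁ q)
        (only (M .solve).k₀ l) (clear M _))
      (cfg (.inl .collect) r [] x [] b (only (M .ask).k₁ q) (only (M .solve).k₁ l')
        (clear M _)) := by
  have := run_guest (c := c) (i := i) (o := o) .solve r x b
    (guests (only (M .ask).k₁ q) (clear M _) (clear M _)) (S := S) h (by
      have : Finset.univ.erase Stage.solve = {.ask, .judge} := by decide
      rw [this]
      simp only [Finset.mem_singleton, reduceCtorEq, not_false_eq_true, Finset.sum_insert,
        Finset.sum_singleton, guests, stackSize_only, List.length_nil]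
      omega)
  simp only [update_guests_solve] at this
  exact this

theorem run_judge (r : Reg M) {s S : ℕ} {l l'}
    (h : RunIn (M .judge).step (fun d => cfgSpace (M .judge) d ≤ s)
      (initList (M .judge) l) (haltList (M .judge) l'))
    (hS : s ≤ S) :
    RunIn (TM2.step (prog M c i o)) (fun d => stackSize d.stk ≤ S)
      (cfg (.inr ⟨.judge, (M .judge).main⟩) r [] [] [] [] (clear M _) (clear M _)
        (only (M .judge).k₀ l))
      (cfg (.inl .finish) r [] [] [] [] (clear M _) (clear M _) (only (M .judge).k₁ l')) := by
  have := run_guest (c := c) (i := i) (o := o) .judge r [] []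
    (guests (clear M _) (clear M _) (clear M _)) (S := S) h (by
      have : Finset.univ.erase Stage.judge = {.ask, .solve} := by decide
      rw [this]
      simpa [guests, stackSize_only] using hS)
  simp only [update_guests_judge] at this
  exact this

/-- The loop over the queries. -/
theorem run_queries {Y : Type} (e : Y → List ((M .solve).Γ (M .solve).k₀))
    (f : Y → (M .solve).Γ (M .solve).k₁) (x) {s S : ℕ} :
    ∀ (ys : List Y) (b) (r : Reg M),
    (∀ y ∈ ys, RunIn (M .solve).step (fun d => cfgSpace (M .solve) d ≤ s)
      (initList (M .solve) (e y)) (haltList (M .solve) [f y])) →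
    -- The factor 2 leaves room for the answers: `b` grows by one symbol per query, while the unread
    -- queries lose at least a separator.
    x.length + b.length + 2 * (ys.flatMap fun y => (e y).map (fun a => c.symm (some a)) ++
      [c.symm none]).length + s + 1 ≤ S →
    ∃ r' : Reg M, RunIn (TM2.step (prog M c i o)) (fun d => stackSize d.stk ≤ S)
      (cfg (.inl .split) r [] x [] b
        (only (M .ask).k₁ (ys.flatMap fun y => (e y).map (fun a => c.symm (some a)) ++
          [c.symm none])) (clear M _) (clear M _))
      (cfg (.inl .putBits) (r.1, none, r'.2.2) [] x [] ((ys.map fun y => o (f y)).reverse ++ b)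
        (clear M _) (clear M _) (clear M _)) := by
  intro ys
  induction ys with
  | nil =>
    intro b r _ hS
    rw [show clear M .ask = only (M .ask).k₁ [] from only_nil _ _]
    refine ⟨r, .head ?_ ?_ (.refl ?_)⟩
    · simp only [size_cfg, stackSize_only, List.length_nil, List.flatMap_nil] at hS ⊢
      omega
    · simp [cfg, prog, code, join, guests, only_self, update_join_guest, update_guests_ask,
        update_only]
    · simp only [size_cfg, stackSize_only, List.length_nil, List.reverse_nil, List.map_nil,
        List.flatMap_nil, List.nil_append] at hS ⊢
      omega
  | cons y ys ih =>
    intro b r hrun hS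
    obtain ⟨r₁, r₂, r₃⟩ := r
    simp only [List.flatMap_cons, List.append_assoc, List.singleton_append, List.length_append,
      List.length_map, List.length_cons] at hS ⊢
    set l := ys.flatMap fun y => (e y).map (fun a => c.symm (some a)) ++ [c.symm none] with hl
    have h1 := run_split (M := M) (c := c) (i := i) (o := o) r₁ r₃ (S := S) x b l (e y) [] r₂
      (by simp only [List.length_nil]; omega)
    have h2 := run_feed (M := M) (c := c) (i := i) (o := o) r₁ r₃ (S := S) x b l
      ((e y).reverse ++ []) [] (some none)
      (by simp only [List.length_append, List.length_reverse, List.length_nil]; omega)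
    have h3 := run_solve (M := M) (c := c) (i := i) (o := o) (r₁, none, r₃) (S := S) x b l
      (hrun y (by simp)) (by omega)
    obtain ⟨r', h5⟩ := ih (o (f y) :: b) (r₁, none, some (o (f y)))
      (fun z hz => hrun z (by simp [hz])) (by simp only [List.length_cons]; omega)
    refine ⟨r', h1.trans (h2.trans ?_)⟩
    simp only [List.append_nil, List.reverse_reverse]
    refine h3.trans (.head h3.right (b := cfg (.inl .split) (r₁, none, some (o (f y))) [] x []
      (o (f y) :: b) (only (M .ask).k₁ l) (clear M _) (clear M _)) ?_ ?_)
    · simp [cfg, prog, code, join, guests, only_self, stepAux_pushSome, update_join_guest,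
        update_join_bits, update_guests_solve, update_only, only_nil _ (M .solve).k₀]
    · simpa using h5

theorem join_clear :
    join M [] [] [] [] (guests (clear M _) (clear M _) (clear M _)) = fun _ => [] := by
  funext k
  rcases k with (_ | _ | _ | _) | ⟨_ | _ | _, k⟩ <;> simp [join, guests, only]

theorem update_clear_ask (w : List ((M .ask).Γ (M .ask).k₀)) :
    Function.update (β := fun k => List (Sym M k)) (fun _ => []) (.inr ⟨.ask, (M .ask).k₀⟩) w =
      join M [] [] [] [] (guests (only (M .ask).k₀ w) (clear M _) (clear M _)) := by
  rw [← join_clear, update_join_guest]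
  simp only [guests, update_only, update_guests_ask]

theorem update_clear_judge (l : List ((M .judge).Γ (M .judge).k₁)) :
    Function.update (β := fun k => List (Sym M k)) (fun _ => []) (.inr ⟨.judge, (M .judge).k₁⟩) l =
      join M [] [] [] [] (guests (clear M _) (clear M _) (only (M .judge).k₁ l)) := by
  rw [← join_clear, update_join_guest]
  simp only [guests, only_nil (M .judge).k₀ (M .judge).k₁, update_only, update_guests_judge]

/-- A complete run of the host. -/
theorem run_machine {Y : Type} (e : Y → List ((M .solve).Γ (M .solve).k₀))
    (f : Y → (M .solve).Γ (M .solve).k₁) {s₁ s₂ s₃ S : ℕ} (w : List ((M .ask).Γ (M .ask).k₀))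
    (ys : List Y) (l : List ((M .judge).Γ (M .judge).k₁))
    (h₁ : RunIn (M .ask).step (fun d => cfgSpace (M .ask) d ≤ s₁)
      (initList (M .ask) w) (haltList (M .ask)
        (ys.flatMap fun y => (e y).map (fun a => c.symm (some a)) ++ [c.symm none])))
    (h₂ : ∀ y ∈ ys, RunIn (M .solve).step (fun d => cfgSpace (M .solve) d ≤ s₂)
      (initList (M .solve) (e y)) (haltList (M .solve) [f y]))
    (h₃ : RunIn (M .judge).step (fun d => cfgSpace (M .judge) d ≤ s₃)
      (initList (M .judge) (w.map i ++ ys.map fun y => o (f y))) (haltList (M .judge) l))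
    (hS : 2 * w.length + 2 * s₁ + s₂ + s₃ + 1 ≤ S) :
    RunIn (machine M c i o).step (fun d => cfgSpace (machine M c i o) d ≤ S)
      (initList (machine M c i o) w) (haltList (machine M c i o) l) := by
  have hout := h₁.right
  rw [cfgSpace_haltList] at hout
  -- Each query costs at least its separator, so the number of answers is bounded by `s₁` too.
  have hlen : ys.length ≤ (ys.flatMap fun y =>
      (e y).map (fun a => c.symm (some a)) ++ [c.symm none]).length := by
    clear h₁ h₂ h₃ hout
    induction ys with
    | nil => simp
    | cons y ys ih =>
      simp only [List.flatMap_cons, List.length_append, List.length_cons, List.length_map] at ih ⊢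
      omega
  have r1 := run_unload (M := M) (c := c) (i := i) (o := o) none none none (S := S) w [] []
    (by simp only [List.length_nil]; omega)
  have r2 := run_reload (M := M) (c := c) (i := i) (o := o) none none none (S := S)
    ((w.map i).reverse ++ []) (w.reverse ++ []) []
    (by simp only [List.length_nil, List.length_append, List.length_reverse, List.length_map]
        omega)
  have r3 := run_ask (M := M) (c := c) (i := i) (o := o) (none, none, none) (S := S)
    ((w.map i).reverse ++ []) h₁
    (by simp only [List.length_nil, List.length_append, List.length_reverse, List.length_map]
        omega)
  obtain ⟨r', r4⟩ := run_queries (M := M) (c := c) (i := i) (o := o) e f ((w.map i).reverse ++ [])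
    (S := S) ys [] (none, none, none) h₂
    (by simp only [List.length_nil, List.length_append, List.length_reverse, List.length_map]
          at hout ⊢
        omega)
  have r5 := run_putBits (M := M) (c := c) (i := i) (o := o) none none (S := S)
    ((w.map i).reverse ++ []) ((ys.map fun y => o (f y)).reverse ++ []) [] r'.2.2
    (by simp only [List.length_nil, List.length_append, List.length_reverse, List.length_map]
        omega)
  have r6 := run_putInput (M := M) (c := c) (i := i) (o := o) none none (S := S)
    ((w.map i).reverse ++ []) (((ys.map fun y => o (f y)).reverse ++ []).reverse ++ []) none
    (by simp only [List.length_nil, List.length_append, List.length_reverse, List.length_map]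
        omega)
  have r7 := run_judge (M := M) (c := c) (i := i) (o := o) (none, none, none) (S := S) h₃
    (by omega)
  simp only [List.append_nil, List.reverse_reverse] at r1 r2 r3 r4 r5 r6
  have r := (r1.trans (r2.trans (r3.trans (r4.trans (r5.trans (r6.trans r7))))))
  have hi : initList (machine M c i o) w = cfg (.inl .unload) (none, none, none) [] [] [] []
      (only (M .ask).k₀ w) (clear M _) (clear M _) := by
    refine (initList_eq (machine M c i o) w).trans ?_
    exact congrArg (TM2.Cfg.mk _ _) (update_clear_ask w)
  have hh : haltList (machine M c i o) l =
      ⟨none, ((none, none, none), fun j => (M j).initialState), join M [] [] [] []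
      (guests (clear M _) (clear M _) (only (M .judge).k₁ l))⟩ := by
    refine (haltList_eq (machine M c i o) l).trans ?_
    exact congrArg (TM2.Cfg.mk _ _) (update_clear_judge l)
  rw [hi, hh]
  exact RunIn.trans r (.head r.right rfl (.refl r.right))

end Host

/-! ### Space bound for parallel queries -/

theorem length_le_listWord {α Γ : Type} (e : Encoding α Γ) (l : List α) :
    l.length ≤ (listWord e l).length := by
  induction l with
  | nil => simp
  | cons a l ih =>
    simp only [listWord, List.flatMap_cons, List.length_append, List.length_cons,
      List.length_map] at ih ⊢
    omega

theorem length_encode_le_listWord {α Γ : Type} (e : Encoding α Γ) {l : List α} {a : α}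
    (h : a ∈ l) : (e.encode a).length ≤ (listWord e l).length := by
  induction l with
  | nil => cases h
  | cons b l ih =>
    simp only [listWord, List.flatMap_cons, List.length_append, List.length_cons,
      List.length_map] at ih ⊢
    rcases List.mem_cons.1 h with rfl | h
    · omega
    · have := ih h
      omega

/-- `P^{PSPACE||} ⊆ PSPACE`. -/
theorem InParallelP.inPSPACE {A : DecisionProblem} (h : InParallelP InPSPACE A) : InPSPACE A := by
  obtain ⟨B, ⟨M, p, hM⟩, q, ev, ⟨hq⟩, ⟨he⟩, hA⟩ := h
  obtain ⟨p₁, h₁⟩ := polySpace_of_polyTime hq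
  obtain ⟨p₃, h₃⟩ := polySpace_of_polyTime he
  let G : Host.Stage → FinTM2 := fun
    | .ask => hq.tm
    | .solve => M.tm
    | .judge => he.tm
  let c : (G .ask).Γ (G .ask).k₁ ≃ Option ((G .solve).Γ (G .solve).k₀) :=
    hq.outputAlphabet.trans (Equiv.optionCongr M.inputAlphabet.symm)
  let i : (G .ask).Γ (G .ask).k₀ → (G .judge).Γ (G .judge).k₀ :=
    fun a => he.inputAlphabet.symm (.inl (hq.inputAlphabet a))
  let o : (G .solve).Γ (G .solve).k₁ → (G .judge).Γ (G .judge).k₀ :=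
    fun z => he.inputAlphabet.symm (.inr (M.outputAlphabet z))
  -- `p₁` bounds the written list of queries, hence the length of each query and their number. So
  -- the solver needs at most `p.comp p₁`, and the judge, on the input and the answers, at most
  -- `p₃.comp (X + p₁)`.
  refine ⟨⟨Host.machine G c i o, hq.inputAlphabet, he.outputAlphabet⟩,
    2 * Polynomial.X + 2 * p₁ + p.comp p₁ + p₃.comp (Polynomial.X + p₁) + 1, fun x => ?_⟩
  have hans : A.answer x = ev (x, (q x).map B.answer) := by
    rw [Bool.eq_iff_iff, ← hA x]
    exact @decide_eq_true_iff _ (Classical.propDecidable _)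
  have hlen := (h₁ x).2
  have run := Host.run_machine (M := G) (c := c) (i := i) (o := o)
    (fun y => (B.enc.encode y).map M.inputAlphabet.symm)
    (fun y => M.outputAlphabet.symm (B.answer y))
    (s₁ := p₁.eval (A.enc.encode x).length)
    (s₂ := p.eval (p₁.eval (A.enc.encode x).length))
    (s₃ := p₃.eval ((A.enc.encode x).length + p₁.eval (A.enc.encode x).length))
    (S := (2 * Polynomial.X + 2 * p₁ + p.comp p₁ + p₃.comp (Polynomial.X + p₁) + 1).eval
      (A.enc.encode x).length)
    ((A.enc.encode x).map hq.inputAlphabet.symm) (q x)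
    ((encodeBool (A.answer x)).map he.outputAlphabet.symm) ?_ ?_ ?_ ?_
  · have hnone : (Host.machine G c i o).step (haltList (Host.machine G c i o)
      ((encodeBool (A.answer x)).map he.outputAlphabet.symm)) = none := rfl
    refine ⟨?_, run.forall_reaches hnone⟩
    obtain ⟨n, hn⟩ := run.stepsWithin
    obtain ⟨r⟩ := hn.evalsToInTime
    exact ⟨r.toEvalsTo⟩
  · have := (h₁ x).1
    convert this using 2
    show _ = List.map _ (listWord B.enc (q x))
    rw [listWord, List.map_flatMap]
    refine List.flatMap_congr fun y _ => ?_
    simp [c, Function.comp_def]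
  · intro y hy
    obtain ⟨⟨r⟩, hs⟩ := hM y
    refine StepsWithin.runIn (n := r.steps) (stepsWithin_of_iterate _ r.evals_in_steps) ?_
    intro d hd
    refine (hs d hd).trans (polynomial_eval_mono p ?_)
    exact (length_encode_le_listWord B.enc hy).trans hlen
  · have := (h₃ (x, (q x).map B.answer)).1
    have hl : ((withBits A.enc).encode (x, (q x).map B.answer)).length =
        (A.enc.encode x).length + (q x).length := by
      simp [withBits, encodingProd, encodingList]
    rw [hl, ← hans] at this
    have hle : (A.enc.encode x).length + (q x).length ≤
        (A.enc.encode x).length + p₁.eval (A.enc.encode x).length :=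
      Nat.add_le_add_left ((length_le_listWord B.enc (q x)).trans hlen) _
    have hm := polynomial_eval_mono p₃ hle
    have hin : List.map i ((A.enc.encode x).map hq.inputAlphabet.symm) ++
        (q x).map (fun y => o (M.outputAlphabet.symm (B.answer y))) =
        ((withBits A.enc).encode (x, (q x).map B.answer)).map he.inputAlphabet.symm := by
      simp [withBits, encodingProd, encodingList, i, o, Function.comp_def]
    rw [hin]
    exact this.imp fun d hd => le_trans hd hm
  · simp only [List.length_map, Polynomial.eval_add, Polynomial.eval_mul, Polynomial.eval_comp,
      Polynomial.eval_X, Polynomial.eval_one, Polynomial.eval_ofNat]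
    omega

/-! ### Characterization of Nash equilibria -/

theorem ResourceLogic.Affine.mono {L : ResourceLogic} (hW : L.Affine) {Γ Γ' Δ : Multiset L.Form}
    (h : Γ ≤ Γ') (hp : L.Provable Γ Δ) : L.Provable Γ' Δ := by
  obtain ⟨Θ, rfl⟩ := Multiset.le_iff_exists_add.1 h
  clear h
  induction Θ using Multiset.induction with
  | empty => simpa using hp
  | cons A Θ ih => simpa using hW _ _ A ih

namespace Game

variable {L : ResourceLogic} (G : Game L)

/-- Additive form, as subtraction of multisets is truncated. -/
theorem out_deviate (P : Fin G.n → Multiset L.Form) (i : Fin G.n) (C : Multiset L.Form) :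
    G.out (G.deviate P i C) + P i = G.out P + C := by
  unfold out deviate
  rw [Finset.sum_update_of_mem (Finset.mem_univ i),
    ← Finset.add_sum_erase _ P (Finset.mem_univ i), Finset.sdiff_singleton_eq_erase]
  abel

theorem out_deviate_mono (P : Fin G.n → Multiset L.Form) (i : Fin G.n) {C D : Multiset L.Form}
    (h : C ≤ D) : G.out (G.deviate P i C) ≤ G.out (G.deviate P i D) := by
  have h1 := G.out_deviate P i C
  have h2 := G.out_deviate P i D
  refine le_of_add_le_add_right (a := P i) ?_
  rw [h1, h2]
  exact add_le_add_right h _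

theorem not_mem_NE_iff (hW : L.Affine) (P : Fin G.n → Multiset L.Form) (hP : P ∈ G.profiles) :
    P ∉ G.NE ↔ ∃ i : Fin G.n,
      (¬ L.Provable (G.out P) {G.goal i} ∧ P i ≠ 0) ∨
      (¬ L.Provable (G.out P) {G.goal i} ∧
        L.Provable (G.out (G.deviate P i (G.endow i))) {G.goal i}) ∨
      (L.Provable (G.out P) {G.goal i} ∧
        ∃ A ∈ P i, L.Provable (G.out (G.deviate P i ((P i).erase A))) {G.goal i}) := by
  have hdev : ∀ i C, G.deviate P i C i = C := fun i C => Function.update_self _ _ _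
  have hNE : P ∉ G.NE ↔ ∃ i, ∃ C ∈ G.ch i, G.StronglyPrefers i (G.deviate P i C) P := by
    simp [NE, hP]
  rw [hNE]
  refine exists_congr fun i => ⟨?_, ?_⟩
  · rintro ⟨C, hC, ⟨-, h2, h3⟩ | ⟨h1, h2⟩ | ⟨h1, h2, h3⟩⟩
    · refine .inl ⟨h2, ?_⟩
      rintro h0
      rw [hdev, h0] at h3
      exact not_lt_bot h3
    · exact .inr (.inl ⟨h2, hW.mono (G.out_deviate_mono P i hC) h1⟩)
    · rw [hdev] at h3
      -- A strictly smaller choice leaves out some occurrence of `A`, hence is contained in `P i`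
      -- with that one occurrence erased; weakening does the rest.
      obtain ⟨A, hA⟩ := Multiset.lt_iff_cons_le.1 h3
      refine .inr (.inr ⟨h2, A, Multiset.mem_of_le hA (Multiset.mem_cons_self _ _),
        hW.mono (G.out_deviate_mono P i ?_) h1⟩)
      simpa using Multiset.erase_le_erase A hA
  · rintro (⟨h1, h2⟩ | ⟨h1, h2⟩ | ⟨h1, A, hA, h2⟩)
    -- The empty choice pays either way: it realizes the goal, or fails it more cheaply.
    · refine ⟨0, Multiset.zero_le _, ?_⟩
      by_cases hs : G.Sat (G.deviate P i 0) i
      · exact .inr (.inl ⟨hs, h1⟩)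
      · refine .inl ⟨hs, h1, ?_⟩
        rw [hdev]
        exact pos_iff_ne_zero.2 h2
    · exact ⟨G.endow i, le_refl (G.endow i), .inr (.inl ⟨h2, h1⟩)⟩
    · refine ⟨(P i).erase A, (Multiset.erase_le A (P i)).trans (hP i), .inr (.inr ⟨h2, h1, ?_⟩)⟩
      rw [hdev]
      exact Multiset.erase_lt.2 hA

end Game

/-! ### Equilibria in terms of written instances -/

namespace NEInstance

variable {L : ResourceLogic}

/-- The formulas played by a list of players. -/
def played (l : List (PlayerData L.Form)) : List L.Form := l.flatMap fun d => d.choice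

/-- The outcome when `C` is played between the players in `pre` and those in `post`. -/
def outcome (pre : List (PlayerData L.Form)) (C : List L.Form) (post : List (PlayerData L.Form)) :
    Multiset L.Form := ((played pre ++ C ++ played post : List L.Form) : Multiset L.Form)

theorem outcome_eq (pre : List (PlayerData L.Form)) (C : List L.Form)
    (post : List (PlayerData L.Form)) :
    outcome pre C post = (played pre : Multiset L.Form) + C + played post := by
  simp [outcome]

/-- Player `d`, between the players in `pre` and those in `post`, has no profitable deviation. -/
def Content (pre : List (PlayerData L.Form)) (d : PlayerData L.Form)
    (post : List (PlayerData L.Form)) : Prop :=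
  -- The endowment has to be tested only for an empty choice, since a nonempty one must realize the
  -- goal outright.
  (d.choice = [] → L.Provable (outcome pre d.endow post) {d.goal} →
    L.Provable (outcome pre d.choice post) {d.goal}) ∧
  (d.choice ≠ [] → L.Provable (outcome pre d.choice post) {d.goal}) ∧
  ∀ l₁ A l₂, d.choice = l₁ ++ A :: l₂ →
    ¬ L.Provable (outcome pre (l₁ ++ l₂) post) {d.goal}

theorem out_profile (I : NEInstance L) :
    I.game.out I.profile = (played I.players : Multiset L.Form) := by
  have h : I.game.out I.profile =
      ∑ i : Fin I.players.length, ((I.players.get i).choice : Multiset L.Form) := rfl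
  rw [h]
  simp only [List.get_eq_getElem]
  rw [Fin.sum_univ_fun_getElem I.players fun d => (d.choice : Multiset L.Form)]
  unfold played
  induction I.players with
  | nil => rfl
  | cons d l ih => simp [ih]

/-- Factorizations of the list replace indices of players: this is the form in which players, and
likewise single occurrences of formulas, are met when the word is scanned. -/
theorem mem_NE_iff (hW : L.Affine) (I : NEInstance L) :
    I.profile ∈ I.game.NE ↔
      ∀ pre d post, I.players = pre ++ d :: post → Content pre d post := by
  have key : ∀ (i : Fin I.game.n) pre d post, I.players = pre ++ d :: post → i.1 = pre.length →
      I.game.goal i = d.goal ∧ I.game.endow i = d.endow ∧ I.profile i = d.choice ∧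
      I.game.out I.profile = outcome pre d.choice post ∧
      ∀ C : List L.Form, I.game.out (I.game.deviate I.profile i C) = outcome pre C post := by
    rintro ⟨i, hlt⟩ pre d post h rfl
    have hget : I.players.get ⟨pre.length, hlt⟩ = d := by simp [h]
    have hout : I.game.out I.profile = outcome pre d.choice post := by
      rw [out_profile, h]
      simp [played, outcome]
    have hch : I.profile ⟨pre.length, hlt⟩ = d.choice := by
      show ((I.players.get ⟨pre.length, hlt⟩).choice : Multiset L.Form) = _
      rw [hget]
    refine ⟨?_, ?_, hch, hout, ?_⟩
    · show (I.players.get ⟨pre.length, hlt⟩).goal = _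
      rw [hget]
    · show ((I.players.get ⟨pre.length, hlt⟩).endow : Multiset L.Form) = _
      rw [hget]
    · intro C
      have := I.game.out_deviate I.profile ⟨pre.length, hlt⟩ C
      rw [hout, hch] at this
      refine add_right_cancel (b := (d.choice : Multiset L.Form)) (this.trans ?_)
      simp only [outcome_eq]
      abel
  have hnot := not_congr (I.game.not_mem_NE_iff hW I.profile I.profile_mem)
  rw [not_not] at hnot
  rw [hnot]
  push Not
  constructor
  · intro h pre d post hs
    have hlt : pre.length < I.players.length := by rw [hs]; simp
    obtain ⟨hg, he, hc, ho, hd⟩ := key ⟨pre.length, hlt⟩ pre d post hs rfl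
    set i : Fin I.game.n := ⟨pre.length, hlt⟩
    obtain ⟨h1, h2, h3⟩ := h i
    rw [hg, hc, ho] at h1
    rw [hg, he, hd, ho] at h2
    rw [hg, hc, ho] at h3
    refine ⟨fun _ hp => ?_, fun hne => ?_, fun l₁ A l₂ hl hp => ?_⟩
    · by_contra hn
      exact h2 hn hp
    · by_contra hn
      exact hne (by simpa using h1 hn)
    -- `h3` presupposes a realized goal; by weakening, provability from the smaller outcome already
    -- supplies it. Hence `Content` has no such premise.
    · refine h3 (hW.mono ?_ hp) A (by simp [hl]) ?_
      · rw [hl]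
        simp only [outcome_eq, ← Multiset.coe_add, ← Multiset.cons_coe]
        gcongr
        exact Multiset.le_cons_self _ _
      · have : (d.choice : Multiset L.Form).erase A = ((l₁ ++ l₂ : List L.Form) : Multiset _) := by
          rw [hl, ← Multiset.coe_add, ← Multiset.cons_coe, Multiset.add_cons,
            Multiset.erase_cons_head, Multiset.coe_add]
        rw [this, hd]
        exact hp
  · intro h i
    obtain ⟨pre, d, post, hs, hi⟩ : ∃ pre d post, I.players = pre ++ d :: post ∧
        i.1 = pre.length := by
      have hlt : i.1 < I.players.length := i.2
      exact ⟨I.players.take i.1, I.players[i.1], I.players.drop (i.1 + 1), by simp,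
        by simpa using hlt.le⟩
    obtain ⟨hg, he, hc, ho, hd⟩ := key i pre d post hs hi
    obtain ⟨h1, h2, h3⟩ := h pre d post hs
    rw [hg, he, hd, hc, ho]
    refine ⟨fun hn => ?_, fun hn hp => ?_, fun hp A hA hp' => ?_⟩
    · by_contra hne
      exact hn (h2 (by simpa using hne))
    · by_cases hne : d.choice = []
      · exact hn (h1 hne hp)
      · exact hn (h2 hne)
    · obtain ⟨l₁, l₂, hl⟩ := List.append_of_mem (Multiset.mem_coe.1 hA)
      have : (d.choice : Multiset L.Form).erase A = ((l₁ ++ l₂ : List L.Form) : Multiset _) := by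
        rw [hl, ← Multiset.coe_add, ← Multiset.cons_coe, Multiset.add_cons,
          Multiset.erase_cons_head, Multiset.coe_add]
      rw [this, hd] at hp'
      exact h3 l₁ A l₂ hl hp'

end NEInstance

/-! ### Words describing games, and the queries read off from them -/

/-- Symbols of a written game: `none` ends a player, `some none` ends a list of formulas,
`some (some none)` ends a formula. -/
abbrev Tok (S : Type) := Option (Option (Option S))

/-- The three lists that describe a player. -/
inductive Part
  | goal | endow | choice
  deriving DecidableEq

instance : Fintype Part := ⟨{.goal, .endow, .choice}, by intro x; cases x <;> simp⟩

/-- The list before this one, cyclically. -/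
def Part.prev : Part → Part
  | .goal => .choice
  | .endow => .goal
  | .choice => .endow

section Transducers

variable {S : Type}

/-- Copy the symbols of formulas if the flag is set. -/
def emit : Bool → Tok S → Option (Tok S)
  | true, some (some x) => some (some (some x))
  | _, _ => none

/-- State change when the antecedent of a query is read off from left to right. The Boolean of the
state says whether formulas are copied, that of the input marks one position of the word: a mark
on the end of the goal selects the endowment, a mark in front of a formula of the choice omits
this formula. -/
def fwdStep : Part × Bool → Tok S × Bool → Part × Bool
  | (.goal, _), (some none, m) => (.endow, m)
  | (.endow, _), (some none, m) => (.choice, !m)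
  | (.choice, _), (some none, _) => (.goal, false)
  | (.choice, _), (some (some none), m) => (.choice, !m)
  | st, _ => st

/-- The antecedent of a query. -/
def fwdOut : Part × Bool → List (Tok S × Bool) → List (Tok S)
  | _, [] => []
  | st, a :: w => (emit st.2 a.1).toList ++ fwdOut (fwdStep st a) w

/-- State change when the goal of the marked player is read off from right to left. -/
def bwdStep : Part × Bool → Tok S × Bool → Part × Bool
  -- The end of a player resets the flag, so that only marks inside the current player count for its
  -- goal.
  | (q, _), (none, _) => (q, false)
  | (q, b), (some none, m) => (q.prev, b || m)
  | (.choice, b), (some (some none), m) => (.choice, b || m)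
  | st, _ => st

/-- Symbols of the goal of the marked player. -/
def bwdEmit (st : Part × Bool) (a : Tok S) : Option (Tok S) :=
  emit (decide (st.1 = .goal) && st.2) a

/-- State after reading from right to left. -/
def bwdState (st : Part × Bool) : List (Tok S × Bool) → Part × Bool
  | [] => st
  | a :: w => bwdStep (bwdState st w) a

/-- The goal of the marked player. -/
def bwdOut (st : Part × Bool) : List (Tok S × Bool) → List (Tok S)
  | [] => []
  | a :: w => (bwdEmit (bwdState st w) a.1).toList ++ bwdOut st w

theorem bwdState_append (st : Part × Bool) (u v : List (Tok S × Bool)) :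
    bwdState st (u ++ v) = bwdState (bwdState st v) u := by
  induction u with
  | nil => rfl
  | cons a u ih => simp [bwdState, ih]

theorem bwdOut_append (st : Part × Bool) (u v : List (Tok S × Bool)) :
    bwdOut st (u ++ v) = bwdOut (bwdState st v) u ++ bwdOut st v := by
  induction u with
  | nil => rfl
  | cons a u ih => simp [bwdOut, ih, bwdState_append]

/-- A word without marks. -/
def plain (w : List (Tok S)) : List (Tok S × Bool) := w.map fun a => (a, false)

@[simp] theorem plain_append (u v : List (Tok S)) : plain (u ++ v) = plain u ++ plain v :=
  List.map_append

@[simp] theorem plain_cons (a : Tok S) (v : List (Tok S)) :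
    plain (a :: v) = (a, false) :: plain v := rfl

@[simp] theorem plain_nil : plain ([] : List (Tok S)) = [] := rfl

@[simp] theorem map_fst_plain (w : List (Tok S)) : (plain w).map Prod.fst = w := by
  simp [plain, Function.comp_def]

/-- The word `p s r` with a mark on `s`. -/
def marked (p : List (Tok S)) (s : Tok S) (r : List (Tok S)) : List (Tok S × Bool) :=
  plain p ++ (s, true) :: plain r

/-- The query for the marked word `p s r`. -/
def query (p : List (Tok S)) (s : Tok S) (r : List (Tok S)) : List (Tok S) :=
  fwdOut (.goal, false) (marked p s r) ++ some none ::
    (bwdOut (.goal, false) (marked p s r) ++ [some none])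

/-- The symbols of a formula, without the end mark. -/
def chars (l : List S) : List (Tok S) := l.map fun c => some (some (some c))

theorem fwdOut_chars (st : Part × Bool) (v : List (Tok S × Bool)) :
    ∀ (l : List S) (w : List (Tok S × Bool)), w.map Prod.fst = chars l →
      fwdOut st (w ++ v) = (if st.2 then chars l else []) ++ fwdOut st v
  | [], w, h => by
    obtain rfl : w = [] := by simpa [chars] using h
    simp [chars]
  | c :: l, [], h => by simp [chars] at h
  | c :: l, (a, m) :: w, h => by
    simp only [chars, List.map_cons, List.cons.injEq] at h
    obtain ⟨rfl, h⟩ := h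
    have ih := fwdOut_chars st v l w h
    have hs : fwdStep st (some (some (some c)), m) = st := by
      rcases st with ⟨_ | _ | _, b⟩ <;> rfl
    rw [List.cons_append, fwdOut, hs, ih]
    rcases st with ⟨q, _ | _⟩ <;> simp [emit, chars]

theorem bwdState_chars (st : Part × Bool) :
    ∀ (l : List S) (w : List (Tok S × Bool)), w.map Prod.fst = chars l → bwdState st w = st
  | [], w, h => by
    obtain rfl : w = [] := by simpa [chars] using h
    rfl
  | c :: l, [], h => by simp [chars] at h
  | c :: l, (a, m) :: w, h => by
    simp only [chars, List.map_cons, List.cons.injEq] at h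
    obtain ⟨rfl, h⟩ := h
    rw [bwdState, bwdState_chars st l w h]
    rcases st with ⟨_ | _ | _, b⟩ <;> rfl

theorem bwdOut_chars (st : Part × Bool) :
    ∀ (l : List S) (w : List (Tok S × Bool)), w.map Prod.fst = chars l →
      bwdOut st w = if st = (.goal, true) then chars l else []
  | [], w, h => by
    obtain rfl : w = [] := by simpa [chars] using h
    simp [bwdOut, chars]
  | c :: l, [], h => by simp [chars] at h
  | c :: l, (a, m) :: w, h => by
    simp only [chars, List.map_cons, List.cons.injEq] at h
    obtain ⟨rfl, h⟩ := h
    rw [bwdOut, bwdState_chars st l w h, bwdOut_chars st l w h]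
    rcases st with ⟨_ | _ | _, _ | _⟩ <;> simp [bwdEmit, emit, chars]

end Transducers

section Words

variable {L : ResourceLogic}

/-- A formula and its end mark. -/
def form (A : L.Form) : List (Tok L.Sym) := chars (L.enc.encode A) ++ [some (some none)]

/-- A list of formulas. -/
def forms (l : List L.Form) : List (Tok L.Sym) := l.flatMap form

@[simp] theorem forms_nil : forms ([] : List L.Form) = [] := rfl

@[simp] theorem forms_cons (A : L.Form) (l : List L.Form) : forms (A :: l) = form A ++ forms l :=
  rfl

@[simp] theorem forms_append (l l' : List L.Form) : forms (l ++ l') = forms l ++ forms l' :=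
  List.flatMap_append

/-- The description of a player. -/
def playerWord (d : PlayerData L.Form) : List (Tok L.Sym) :=
  forms [d.goal] ++ some none :: (forms d.endow ++ some none ::
    (forms d.choice ++ [some none, none]))

/-- The description of a list of players. -/
def word (l : List (PlayerData L.Form)) : List (Tok L.Sym) := l.flatMap playerWord

@[simp] theorem word_nil : word ([] : List (PlayerData L.Form)) = [] := rfl

@[simp] theorem word_cons (d : PlayerData L.Form) (l : List (PlayerData L.Form)) :
    word (d :: l) = playerWord d ++ word l := rfl

@[simp] theorem word_append (l l' : List (PlayerData L.Form)) :
    word (l ++ l') = word l ++ word l' :=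
  List.flatMap_append

theorem map_some_listWord (l : List L.Form) :
    ((listWord L.enc l).map some).map some = forms l := by
  induction l with
  | nil => rfl
  | cons A l ih =>
    rw [forms_cons, ← ih]
    simp [listWord, form, chars, Function.comp_def]

theorem enc_eq_word (I : NEInstance L) : (NEInstance.enc L).encode I = word I.players := by
  show listWord (listEnc (listEnc L.enc)) (I.players.map fun d => [[d.goal], d.endow, d.choice]) = _
  rw [listWord, List.flatMap_map, word]
  refine List.flatMap_congr fun d _ => ?_
  show (listWord (listEnc L.enc) [[d.goal], d.endow, d.choice]).map some ++ [none] = _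
  simp only [listWord, List.flatMap_cons, List.flatMap_nil, playerWord, ← map_some_listWord]
  simp [listEnc, encodingOfInjective, listWord]

/-- The description of a sequent. -/
def seqWord (Γ Δ : List L.Form) : List (Tok L.Sym) :=
  forms Γ ++ some none :: (forms Δ ++ [some none])

theorem map_some_enc_validity (Γ Δ : List L.Form) :
    (L.validity.enc.encode (Γ, Δ)).map some = seqWord Γ Δ := by
  show (listWord (listEnc L.enc) [Γ, Δ]).map some = _
  simp only [listWord, List.flatMap_cons, List.flatMap_nil, ← map_some_listWord,
    seqWord]
  simp [listEnc, encodingOfInjective, listWord]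

/-! #### Queries are well-formed -/

/-- The flag can change only at the end mark, and only after that symbol has been treated. So a
formula is copied entirely or not at all, wherever the marks are. -/
theorem fwdOut_form (q : Part) (b : Bool) (A : L.Form) {w : List (Tok L.Sym × Bool)}
    (h : w.map Prod.fst = form A) :
    ∃ b', ∀ v, fwdOut (q, b) (w ++ v) = (if b then form A else []) ++ fwdOut (q, b') v := by
  obtain ⟨u, t, rfl, hu, ht⟩ := List.map_eq_append_iff.1 h
  obtain ⟨⟨a, m⟩, rfl, rfl⟩ : ∃ x, t = [x] ∧ x.1 = some (some none) := by
    rcases t with _ | ⟨x, _ | _⟩ <;> simp at ht ⊢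
    exact ht
  refine ⟨if q = .choice then !m else b, fun v => ?_⟩
  rw [List.append_assoc, fwdOut_chars _ _ _ _ hu]
  rcases q with _ | _ | _ <;> cases b <;> simp [fwdOut, fwdStep, emit, form]

theorem fwdOut_forms (q : Part) : ∀ (l : List L.Form) (b : Bool) (w : List (Tok L.Sym × Bool)),
    w.map Prod.fst = forms l →
    ∃ l' b', ∀ v, fwdOut (q, b) (w ++ v) = forms l' ++ fwdOut (q, b') v
  | [], b, w, h => by
    obtain rfl : w = [] := by simpa using h
    exact ⟨[], b, fun v => rfl⟩
  | A :: l, b, w, h => by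
    obtain ⟨u, t, rfl, hu, ht⟩ := List.map_eq_append_iff.1 h
    obtain ⟨b', h1⟩ := fwdOut_form q b A hu
    obtain ⟨l', b'', h2⟩ := fwdOut_forms q l b' t ht
    refine ⟨(if b then [A] else []) ++ l', b'', fun v => ?_⟩
    rw [List.append_assoc, h1, h2]
    cases b <;> simp

theorem exists_segments {d : PlayerData L.Form} {w : List (Tok L.Sym × Bool)}
    (h : w.map Prod.fst = playerWord d) :
    ∃ g e c m₁ m₂ m₃ m₄, g.map Prod.fst = forms [d.goal] ∧ e.map Prod.fst = forms d.endow ∧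
      c.map Prod.fst = forms d.choice ∧
      w = g ++ (some none, m₁) :: (e ++ (some none, m₂) ::
        (c ++ [(some none, m₃), (none, m₄)])) := by
  obtain ⟨g, t₁, rfl, hg, h₁⟩ := List.map_eq_append_iff.1 h
  obtain ⟨⟨_, m₁⟩, t₂, rfl, rfl, h₂⟩ := List.map_eq_cons_iff.1 h₁
  obtain ⟨e, t₃, rfl, he, h₃⟩ := List.map_eq_append_iff.1 h₂
  obtain ⟨⟨_, m₂⟩, t₄, rfl, rfl, h₄⟩ := List.map_eq_cons_iff.1 h₃
  obtain ⟨c, t₅, rfl, hc, h₅⟩ := List.map_eq_append_iff.1 h₄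
  obtain ⟨⟨_, m₃⟩, t₆, rfl, rfl, h₆⟩ := List.map_eq_cons_iff.1 h₅
  obtain ⟨⟨_, m₄⟩, t₇, rfl, rfl, h₇⟩ := List.map_eq_cons_iff.1 h₆
  obtain rfl : t₇ = [] := by simpa using h₇
  exact ⟨g, e, c, m₁, m₂, m₃, m₄, hg, he, hc, rfl⟩

theorem fwdOut_word : ∀ (l : List (PlayerData L.Form)) (w : List (Tok L.Sym × Bool)),
    w.map Prod.fst = word l → ∃ l', fwdOut (.goal, false) w = forms l'
  | [], w, h => by
    obtain rfl : w = [] := by simpa using h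
    exact ⟨[], rfl⟩
  | d :: l, w, h => by
    obtain ⟨u, t, rfl, hu, ht⟩ := List.map_eq_append_iff.1 h
    obtain ⟨l', hl⟩ := fwdOut_word l t ht
    obtain ⟨g, e, c, m₁, m₂, m₃, m₄, hg, he, hc, rfl⟩ := exists_segments hu
    obtain ⟨l₁, b₁, h1⟩ := fwdOut_forms .goal _ false g hg
    obtain ⟨l₂, b₂, h2⟩ := fwdOut_forms .endow _ m₁ e he
    obtain ⟨l₃, b₃, h3⟩ := fwdOut_forms .choice _ (!m₂) c hc
    refine ⟨l₁ ++ (l₂ ++ (l₃ ++ l')), ?_⟩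
    simp [h1, h2, h3, fwdOut, fwdStep, emit, hl]

/-- Inside a goal the flag is constant, so the goal comes out whole or not at all. Inside a choice a
mark on the end of a formula may raise it, hence the unspecified `b'`. -/
theorem bwdOut_forms : ∀ (l : List L.Form) (q : Part) (b : Bool) (w : List (Tok L.Sym × Bool)),
    w.map Prod.fst = forms l →
    (∃ b', bwdState (q, b) w = (q, if q = .choice then b' else b)) ∧
      bwdOut (q, b) w = if (q, b) = (.goal, true) then forms l else []
  | [], q, b, w, h => by
    obtain rfl : w = [] := by simpa using h
    exact ⟨⟨b, by simp [bwdState]⟩, by simp [bwdOut]⟩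
  | A :: l, q, b, w, h => by
    obtain ⟨u, t, rfl, hu, ht⟩ := List.map_eq_append_iff.1 h
    obtain ⟨⟨b', h1⟩, h2⟩ := bwdOut_forms l q b t ht
    obtain ⟨v, t', rfl, hv, ht'⟩ := List.map_eq_append_iff.1 hu
    obtain ⟨⟨a, m⟩, rfl, rfl⟩ : ∃ x, t' = [x] ∧ x.1 = some (some none) := by
      rcases t' with _ | ⟨x, _ | _⟩ <;> simp at ht' ⊢
      exact ht'
    simp only [bwdState_append, bwdOut_append, h1, h2, bwdState_chars _ _ _ hv,
      bwdOut_chars _ _ _ hv]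
    refine ⟨⟨b' || m, ?_⟩, ?_⟩ <;> rcases q with _ | _ | _ <;> cases b <;>
      simp [bwdState, bwdOut, bwdStep, bwdEmit, emit, form]

theorem bwdOut_playerWord {d : PlayerData L.Form} (b : Bool) {w : List (Tok L.Sym × Bool)}
    (h : w.map Prod.fst = playerWord d) :
    ∃ b', bwdState (.goal, b) w = (.goal, b') ∧
      bwdOut (.goal, b) w = if b' then forms [d.goal] else [] := by
  obtain ⟨g, e, c, m₁, m₂, m₃, m₄, hg, he, hc, rfl⟩ := exists_segments h
  obtain ⟨⟨b₃, h3⟩, h3'⟩ := bwdOut_forms _ .choice m₃ c hc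
  obtain ⟨⟨b₂, h2⟩, h2'⟩ := bwdOut_forms _ .endow (b₃ || m₂) e he
  obtain ⟨⟨b₁, h1⟩, h1'⟩ := bwdOut_forms _ .goal (b₃ || m₂ || m₁) g hg
  simp only [reduceCtorEq, if_true, if_false, Prod.mk.injEq, false_and, true_and] at *
  refine ⟨b₃ || m₂ || m₁, ?_, ?_⟩
  · simp [bwdState_append, bwdState, bwdStep, Part.prev, h1, h2, h3]
  · simp [bwdState_append, bwdOut_append, bwdState, bwdOut, bwdStep, bwdEmit, emit, Part.prev,
      h2, h3, h1', h2', h3']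

theorem bwdOut_word : ∀ (l : List (PlayerData L.Form)) (w : List (Tok L.Sym × Bool)),
    w.map Prod.fst = word l →
    ∃ l' b', bwdState (.goal, false) w = (.goal, b') ∧ bwdOut (.goal, false) w = forms l'
  | [], w, h => by
    obtain rfl : w = [] := by simpa using h
    exact ⟨[], false, rfl, rfl⟩
  | d :: l, w, h => by
    obtain ⟨u, t, rfl, hu, ht⟩ := List.map_eq_append_iff.1 h
    obtain ⟨l', b, h1, h2⟩ := bwdOut_word l t ht
    obtain ⟨b', h3, h4⟩ := bwdOut_playerWord b hu
    refine ⟨(if b' then [d.goal] else []) ++ l', b', ?_, ?_⟩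
    · rw [bwdState_append, h1, h3]
    · rw [bwdOut_append, h1, h2, h4]
      cases b' <;> simp

/-- Most marks ask something irrelevant, but all of them are asked, and the output of the query
writer has to be the encoding of a list of sequents. -/
theorem exists_query_eq {l : List (PlayerData L.Form)} {p : List (Tok L.Sym)} {s : Tok L.Sym}
    {r : List (Tok L.Sym)} (h : p ++ s :: r = word l) :
    ∃ Γ Δ : List L.Form, query p s r = seqWord Γ Δ := by
  have h' : (marked p s r).map Prod.fst = word l := by simp [marked, ← h]
  obtain ⟨Γ, h1⟩ := fwdOut_word l _ h'
  obtain ⟨Δ, b, -, h2⟩ := bwdOut_word l _ h'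
  refine ⟨Γ, Δ, ?_⟩
  rw [seqWord, query, h1, h2]

/-! #### The relevant queries -/

/-- In a choice every unmarked end of a formula turns copying on, so there the flag stays constant
only if it is `true`. -/
theorem fwdOut_plain_forms (q : Part) (b : Bool) (l : List L.Form) (hq : q = .choice → b = true)
    (v : List (Tok L.Sym × Bool)) :
    fwdOut (q, b) (plain (forms l) ++ v) = (if b then forms l else []) ++ fwdOut (q, b) v := by
  induction l with
  | nil => simp
  | cons A l ih =>
    have : fwdOut (q, b) ((some (some none), false) :: (plain (forms l) ++ v)) =
        (if b then [some (some none)] else []) ++ fwdOut (q, b) (plain (forms l) ++ v) := by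
      rcases q with _ | _ | _
      · cases b <;> simp [fwdOut, fwdStep, emit]
      · cases b <;> simp [fwdOut, fwdStep, emit]
      · cases hq rfl
        simp [fwdOut, fwdStep, emit]
    rw [forms_cons, form, plain_append, plain_append, plain_cons, plain_nil, List.append_assoc,
      List.append_assoc, fwdOut_chars (q, b) _ _ _ (map_fst_plain _), List.singleton_append, this,
      ih]
    cases b <;> simp

theorem fwdOut_plain_playerWord (d : PlayerData L.Form) (v : List (Tok L.Sym × Bool)) :
    fwdOut (.goal, false) (plain (playerWord d) ++ v) =
      forms d.choice ++ fwdOut (.goal, false) v := by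
  simp only [playerWord, plain_append, plain_cons, plain_nil, List.append_assoc, List.cons_append,
    List.nil_append]
  rw [fwdOut_plain_forms _ _ _ (by simp)]
  simp only [fwdOut, fwdStep]
  rw [fwdOut_plain_forms _ _ _ (by simp)]
  simp only [fwdOut, fwdStep]
  rw [fwdOut_plain_forms _ _ _ (by simp)]
  simp [fwdOut, fwdStep, emit]

theorem fwdOut_plain_word (l : List (PlayerData L.Form)) (v : List (Tok L.Sym × Bool)) :
    fwdOut (.goal, false) (plain (word l) ++ v) =
      forms (NEInstance.played l) ++ fwdOut (.goal, false) v := by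
  induction l with
  | nil => rfl
  | cons d l ih =>
    rw [word_cons, plain_append, List.append_assoc, fwdOut_plain_playerWord, ih]
    simp [NEInstance.played]

/-- The first formula after a mark is omitted. -/
theorem fwdOut_skip (l : List L.Form) (v : List (Tok L.Sym × Bool)) :
    fwdOut (.choice, false) (plain (forms l) ++ (some none, false) :: v) =
      forms l.tail ++ fwdOut (.goal, false) v := by
  cases l with
  -- If no formula follows the mark, nothing is omitted; such a mark therefore asks about the
  -- profile itself.
  | nil => simp [fwdOut, fwdStep, emit]
  | cons A l =>
    rw [forms_cons, form, plain_append, plain_append, plain_cons, plain_nil, List.append_assoc,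
      List.append_assoc, fwdOut_chars _ _ _ _ (map_fst_plain _), List.singleton_append]
    simp only [fwdOut, fwdStep]
    rw [Bool.not_false, fwdOut_plain_forms _ _ _ (by simp)]
    simp [fwdOut, fwdStep, emit]

theorem bwdState_plain_forms (q : Part) (b : Bool) (l : List L.Form) :
    bwdState (q, b) (plain (forms l)) = (q, b) := by
  induction l with
  | nil => rfl
  | cons A l ih =>
    rw [forms_cons, form, plain_append, plain_append, bwdState_append, bwdState_append, ih,
      bwdState_chars _ _ _ (map_fst_plain _)]
    rcases q with _ | _ | _ <;> simp [bwdState, bwdStep]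

theorem bwdOut_plain_forms (q : Part) (b : Bool) (l : List L.Form) :
    bwdOut (q, b) (plain (forms l)) = if (q, b) = (.goal, true) then forms l else [] :=
  (bwdOut_forms l q b _ (map_fst_plain _)).2

/-- The closing `none`, read first, clears the flag: a mark on a later player does not leak into
earlier ones. -/
theorem bwd_plain_playerWord (b : Bool) (d : PlayerData L.Form) :
    bwdState (.goal, b) (plain (playerWord d)) = (.goal, false) ∧
      bwdOut (.goal, b) (plain (playerWord d)) = [] := by
  constructor <;>
  simp [playerWord, bwdState_append, bwdOut_append, bwdState, bwdOut, bwdStep, bwdEmit, emit,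
    Part.prev, bwdState_plain_forms, bwdOut_plain_forms, -forms_cons]

theorem bwd_plain_word (b : Bool) (l : List (PlayerData L.Form)) :
    (bwdState (.goal, b) (plain (word l))).1 = .goal ∧
      (b = false → (bwdState (.goal, b) (plain (word l))).2 = false) ∧
      bwdOut (.goal, b) (plain (word l)) = [] := by
  induction l with
  | nil => exact ⟨rfl, fun h => h, rfl⟩
  | cons d l ih =>
    obtain ⟨h1, h2, h3⟩ := ih
    rw [word_cons, plain_append, bwdState_append, bwdOut_append, h3]
    generalize hst : bwdState (.goal, b) (plain (word l)) = st at *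
    obtain ⟨q, b'⟩ := st
    obtain rfl : q = .goal := h1
    obtain ⟨h4, h5⟩ := bwd_plain_playerWord b' d
    rw [h4, h5]
    exact ⟨rfl, fun _ => rfl, rfl⟩

/-- The succedent of a query is determined by the marked player. -/
theorem bwdOut_context (pre post : List (PlayerData L.Form)) (l : List L.Form)
    {w : List (Tok L.Sym × Bool)} (h : bwdState (.goal, false) w = (.goal, true))
    (h' : bwdOut (.goal, false) w = forms l) :
    bwdOut (.goal, false) (plain (word pre) ++ (w ++ plain (word post))) = forms l := by
  obtain ⟨h1, h2, h3⟩ := bwd_plain_word false post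
  have h4 : bwdState (.goal, false) (plain (word post)) = (.goal, false) :=
    Prod.ext h1 (h2 rfl)
  rw [bwdOut_append, bwdState_append, bwdOut_append, h4, h, h', h3, (bwd_plain_word _ _).2.2]
  simp

/-- Mark on the end of the goal. -/
theorem query_goal (pre : List (PlayerData L.Form)) (d : PlayerData L.Form)
    (post : List (PlayerData L.Form)) (h : d.choice = []) :
    query (word pre ++ forms [d.goal]) (some none)
      (forms d.endow ++ some none :: (forms d.choice ++ [some none, none]) ++ word post) =
    seqWord (NEInstance.played pre ++ d.endow ++ NEInstance.played post) [d.goal] := by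
  have hb := bwdOut_context pre post [d.goal] (w := plain (forms [d.goal]) ++
    (some none, true) :: plain (forms d.endow ++ some none :: (forms d.choice ++
      [some none, none])))
    (by simp [bwdState_append, bwdState, bwdStep, Part.prev, bwdState_plain_forms, -forms_cons])
    (by simp [bwdState_append, bwdState, bwdOut_append, bwdOut, bwdStep, bwdEmit, emit, Part.prev,
          bwdState_plain_forms, bwdOut_plain_forms, -forms_cons])
  have hf : fwdOut (.goal, false) (marked (word pre ++ forms [d.goal]) (some none)
      (forms d.endow ++ some none :: (forms d.choice ++ [some none, none]) ++ word post)) =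
      forms (NEInstance.played pre ++ d.endow ++ NEInstance.played post) := by
    have hp := fwdOut_plain_word post []
    simp only [List.append_nil] at hp
    simp only [marked, plain_append, plain_cons, List.append_assoc, List.cons_append,
      List.nil_append, fwdOut_plain_word]
    rw [fwdOut_plain_forms _ _ _ (by simp)]
    simp only [fwdOut, fwdStep]
    rw [fwdOut_plain_forms _ _ _ (by simp)]
    -- The choice is copied in addition to the endowment; the query is the intended one only because
    -- the choice is empty.
    simp [fwdOut, fwdStep, emit, h, hp]
  rw [seqWord, query, hf]
  congr 3
  simpa [marked] using hb

/-- Mark in front of the formulas `l₂`. -/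
theorem query_choice (pre : List (PlayerData L.Form)) (d : PlayerData L.Form)
    (post : List (PlayerData L.Form)) (l₁ : List L.Form) (A : L.Form)
    (l₂ : List L.Form) :
    query (word pre ++ (forms [d.goal] ++ some none :: (forms d.endow ++ some none ::
      (forms l₁ ++ chars (L.enc.encode A))))) (some (some none))
      (forms l₂ ++ [some none, none] ++ word post) =
    seqWord (NEInstance.played pre ++ (l₁ ++ A :: l₂.tail) ++ NEInstance.played post) [d.goal] := by
  have hb := bwdOut_context pre post [d.goal] (w := plain (forms [d.goal] ++
    some none :: (forms d.endow ++ some none ::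
      (forms l₁ ++ chars (L.enc.encode A)))) ++ (some (some none), true) ::
      plain (forms l₂ ++ [some none, none]))
    (by simp [bwdState_append, bwdState, bwdStep, Part.prev, bwdState_plain_forms,
          bwdState_chars _ _ _ (map_fst_plain _), -forms_cons])
    (by simp [bwdState_append, bwdState, bwdOut_append, bwdOut, bwdStep, bwdEmit, emit, Part.prev,
          bwdState_plain_forms, bwdOut_plain_forms, bwdState_chars _ _ _ (map_fst_plain _),
          bwdOut_chars _ _ _ (map_fst_plain _), -forms_cons])
  have hf : fwdOut (.goal, false) (marked (word pre ++ (forms [d.goal] ++ some none ::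
      (forms d.endow ++ some none :: (forms l₁ ++ chars (L.enc.encode A))))) (some (some none))
      (forms l₂ ++ [some none, none] ++ word post)) =
      forms (NEInstance.played pre ++ (l₁ ++ A :: l₂.tail) ++ NEInstance.played post) := by
    have hp := fwdOut_plain_word post []
    simp only [List.append_nil] at hp
    simp only [marked, plain_append, plain_cons, List.append_assoc, List.cons_append,
      List.nil_append, fwdOut_plain_word]
    rw [fwdOut_plain_forms _ _ _ (by simp)]
    simp only [fwdOut, fwdStep]
    rw [fwdOut_plain_forms _ _ _ (by simp)]
    simp only [fwdOut, fwdStep, Bool.not_false]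
    rw [fwdOut_plain_forms _ _ _ (by simp), fwdOut_chars _ _ _ _ (map_fst_plain _)]
    simp only [fwdOut, fwdStep, Bool.not_true, fwdOut_skip]
    simp [fwdOut, emit, hp, form]
  rw [seqWord, query, hf]
  congr 3
  simpa [marked] using hb

/-- Mark in front of the first formula of the choice. -/
theorem query_endow (pre : List (PlayerData L.Form)) (d : PlayerData L.Form)
    (post : List (PlayerData L.Form)) :
    query (word pre ++ (forms [d.goal] ++ some none :: forms d.endow)) (some none)
      (forms d.choice ++ [some none, none] ++ word post) =
    seqWord (NEInstance.played pre ++ d.choice.tail ++ NEInstance.played post) [d.goal] := by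
  have hb := bwdOut_context pre post [d.goal] (w := plain (forms [d.goal] ++
    some none :: forms d.endow) ++ (some none, true) ::
      plain (forms d.choice ++ [some none, none]))
    (by simp [bwdState_append, bwdState, bwdStep, Part.prev, bwdState_plain_forms, -forms_cons])
    (by simp [bwdState_append, bwdState, bwdOut_append, bwdOut, bwdStep, bwdEmit, emit, Part.prev,
          bwdState_plain_forms, bwdOut_plain_forms, -forms_cons])
  have hf : fwdOut (.goal, false) (marked (word pre ++ (forms [d.goal] ++ some none ::
      forms d.endow)) (some none) (forms d.choice ++ [some none, none] ++ word post)) =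
      forms (NEInstance.played pre ++ d.choice.tail ++ NEInstance.played post) := by
    have hp := fwdOut_plain_word post []
    simp only [List.append_nil] at hp
    simp only [marked, plain_append, plain_cons, List.append_assoc, List.cons_append,
      List.nil_append, fwdOut_plain_word]
    rw [fwdOut_plain_forms _ _ _ (by simp)]
    simp only [fwdOut, fwdStep]
    rw [fwdOut_plain_forms _ _ _ (by simp)]
    simp only [fwdOut, fwdStep, Bool.not_true, fwdOut_skip]
    simp [fwdOut, emit, hp]
  rw [seqWord, query, hf]
  congr 3
  simpa [marked] using hb

end Words

/-! ### Evaluation of the answers -/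

/-- Position of the evaluation, which reads a game from right to left. -/
inductive Phase
  | out | first | rest | endow (sat : Bool)
  deriving DecidableEq

instance : Fintype Phase :=
  ⟨{.out, .first, .rest, .endow false, .endow true}, by rintro (_ | _ | _ | _ | _) <;> simp⟩

section

variable {S : Type}

/-- Evaluation reads each symbol together with the answer to the query marked there. -/
def evStep : Phase × Bool → Tok S × Bool → Phase × Bool
  | (.out, k), (some none, _) => (.first, k)
  -- At the last formula of a choice nothing is omitted: the answer says whether the goal is
  -- realized.
  | (.first, k), (some (some none), b) => (.rest, k && b)
  -- Empty choice: again the answer concerns the profile itself, and is kept for comparison with the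
  -- endowment.
  | (.first, k), (some none, b) => (.endow b, k)
  | (.rest, k), (some (some none), b) => (.rest, k && !b)
  -- This tests the omission of the first formula. The value `true` makes the next answer
  -- irrelevant: for a nonempty choice the endowment query is not the intended one.
  | (.rest, k), (some none, b) => (.endow true, k && !b)
  | (.endow s, k), (some none, b) => (.out, k && (s || !b))
  | st, _ => st

/-- Evaluation of the part `u` of the word `p u r`, where `bit` provides the answers. -/
def evState (bit : List (Tok S) → Tok S → List (Tok S) → Bool) (st : Phase × Bool) :
    List (Tok S) → List (Tok S) → List (Tok S) → Phase × Bool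
  | _, [], _ => st
  | p, s :: u, r => evStep (evState bit st (p ++ [s]) u r) (s, bit p s (u ++ r))

theorem evState_append (bit : List (Tok S) → Tok S → List (Tok S) → Bool) (st : Phase × Bool)
    (p u v r : List (Tok S)) :
    evState bit st p (u ++ v) r = evState bit (evState bit st (p ++ u) v r) p u (v ++ r) := by
  induction u generalizing p with
  | nil => simp [evState]
  | cons s u ih => simp [evState, ih]

/-- Evaluation of a reversed word with a list of answers. -/
def evList : Phase × Bool → List (Tok S) → List Bool → Phase × Bool
  | st, [], _ => st
  | st, s :: u, bits => evList (evStep st (s, bits.headD false)) u bits.tail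

theorem evList_append (st : Phase × Bool) (u v : List (Tok S)) (bits : List Bool) :
    evList st (u ++ v) bits = evList (evList st u bits) v (bits.drop u.length) := by
  induction u generalizing st bits with
  | nil => rfl
  | cons s u ih => simp [evList, ih]

/-- All queries for marks in the part `u` of the word `p u r`. -/
def queries : List (Tok S) → List (Tok S) → List (Tok S) → List (List (Tok S))
  | _, [], _ => []
  | p, s :: u, r => query p s (u ++ r) :: queries (p ++ [s]) u r

theorem queries_append (p u v r : List (Tok S)) :
    queries p (u ++ v) r = queries p u (v ++ r) ++ queries (p ++ u) v r := by
  induction u generalizing p with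
  | nil => simp [queries]
  | cons s u ih => simp [queries, ih]

theorem length_queries (p u r : List (Tok S)) : (queries p u r).length = u.length := by
  induction u generalizing p with
  | nil => rfl
  | cons s u ih => simp [queries, ih]

/-- Reversing both the word and the answers aligns each symbol with the answer to its own mark;
further bits are never read. -/
theorem evList_queries (f : List (Tok S) → Bool) (st : Phase × Bool) (p u r : List (Tok S)) :
    ∀ bits, evList st u.reverse (((queries p u r).map f).reverse ++ bits) =
      evState (fun p s r => f (query p s r)) st p u r := by
  induction u generalizing p with
  | nil => exact fun _ => rfl
  | cons s u ih =>
    intro bits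
    rw [List.reverse_cons, evList_append, queries, List.map_cons, List.reverse_cons,
      List.append_assoc, ih]
    rw [List.drop_append_of_le_length (by simp [length_queries])]
    rw [List.drop_eq_nil_of_le (by simp [length_queries])]
    rfl

end

section

variable {L : ResourceLogic}

/-- The sequent described by a word. -/
noncomputable def toSeq (w : List (Tok L.Sym)) : L.validity.Inst :=
  -- The default is harmless, as all words decoded below are of the form `seqWord Γ Δ`.
  (L.validity.enc.decode w.reduceOption).getD (([], []) : List L.Form × List L.Form)

theorem toSeq_map_some (y : L.validity.Inst) : toSeq ((L.validity.enc.encode y).map some) = y := by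
  unfold toSeq
  have : (List.map some (L.validity.enc.encode y)).reduceOption = L.validity.enc.encode y := by
    simp [List.reduceOption]
  refine (congrArg (fun w => (L.validity.enc.decode w).getD
    (([], []) : List L.Form × List L.Form)) this).trans ?_
  rw [Encoding.decode_encode]
  rfl

theorem toSeq_seqWord (Γ Δ : List L.Form) : toSeq (seqWord Γ Δ) = (Γ, Δ) := by
  rw [← map_some_enc_validity]
  exact toSeq_map_some _

/-- The answer to a query. -/
noncomputable def answer (w : List (Tok L.Sym)) : Bool := L.validity.answer (toSeq w)

theorem answer_seqWord (Γ Δ : List L.Form) :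
    answer (seqWord Γ Δ) = true ↔ L.Provable Γ Δ := by
  rw [answer, toSeq_seqWord]
  exact @decide_eq_true_iff _ (Classical.propDecidable _)

/-- The answer to the query with a given mark. -/
noncomputable def answerAt (p : List (Tok L.Sym)) (s : Tok L.Sym) (r : List (Tok L.Sym)) : Bool :=
  answer (query p s r)

/-! ### Correctness of the evaluation -/

theorem evState_chars (bit : List (Tok L.Sym) → Tok L.Sym → List (Tok L.Sym) → Bool)
    (st : Phase × Bool) (p r : List (Tok L.Sym)) (l : List L.Sym) :
    evState bit st p (chars l) r = st := by
  induction l generalizing p with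
  | nil => rfl
  | cons c l ih =>
    rw [chars, List.map_cons, evState, ← chars, ih]
    rcases st with ⟨_ | _ | _ | _, k⟩ <;> rfl

theorem evState_forms (bit : List (Tok L.Sym) → Tok L.Sym → List (Tok L.Sym) → Bool)
    (st : Phase × Bool) (hst : st.1 = .out ∨ ∃ b, st.1 = .endow b) (p r : List (Tok L.Sym))
    (l : List L.Form) :
    evState bit st p (forms l) r = st := by
  induction l generalizing p with
  | nil => rfl
  | cons A l ih =>
    rw [forms_cons, evState_append, ih, form, evState_append, evState, evState, evState_chars]
    rcases st with ⟨_ | _ | _ | _, k⟩ <;> simp [evStep] at hst ⊢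

theorem evState_forms_out (bit : List (Tok L.Sym) → Tok L.Sym → List (Tok L.Sym) → Bool)
    (k : Bool) (p r : List (Tok L.Sym)) (l : List L.Form) :
    evState bit (.out, k) p (forms l) r = (.out, k) :=
  evState_forms bit _ (.inl rfl) p r l

theorem evState_forms_endow (bit : List (Tok L.Sym) → Tok L.Sym → List (Tok L.Sym) → Bool)
    (b k : Bool) (p r : List (Tok L.Sym)) (l : List L.Form) :
    evState bit (.endow b, k) p (forms l) r = (.endow b, k) :=
  evState_forms bit _ (.inr ⟨b, rfl⟩) p r l

/-- Evaluation of the formulas `l₂` that remain of a choice `l₁ ++ l₂`. -/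
theorem evState_choice (pre : List (PlayerData L.Form)) (d : PlayerData L.Form)
    (post : List (PlayerData L.Form)) (k : Bool) : ∀ (l₂ l₁ : List L.Form),
    d.choice = l₁ ++ l₂ → l₂ ≠ [] →
    ∃ k', evState answerAt (.first, k) (word pre ++ (forms [d.goal] ++ some none ::
        (forms d.endow ++ some none :: forms l₁))) (forms l₂) ([some none, none] ++ word post) =
      (.rest, k') ∧ (k' = true ↔ k = true ∧
        L.Provable (NEInstance.outcome pre d.choice post) {d.goal} ∧
        -- The omission of the first formula of `l₂` is tested one separator further left, outside
        -- this part of the word.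
        ∀ m₁ A m₂, l₂ = m₁ ++ A :: m₂ → m₁ ≠ [] →
          ¬ L.Provable (NEInstance.outcome pre (l₁ ++ m₁ ++ m₂) post) {d.goal})
  | [], _, _, h => absurd rfl h
  | A :: l₂, l₁, h, _ => by
    have hq := query_choice pre d post l₁ A l₂
    have hctx : word pre ++ (forms [d.goal] ++ some none ::
        (forms d.endow ++ some none :: forms (l₁ ++ [A]))) = word pre ++ (forms [d.goal] ++
        some none :: (forms d.endow ++ some none :: forms l₁)) ++ form A := by
      simp
    have hbit : answerAt (word pre ++ (forms [d.goal] ++ some none :: (forms d.endow ++ some none ::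
          (forms l₁ ++ chars (L.enc.encode A))))) (some (some none))
          (forms l₂ ++ ([some none, none] ++ word post)) = true ↔
        L.Provable (NEInstance.outcome pre (l₁ ++ A :: l₂.tail) post) {d.goal} := by
      rw [answerAt, ← List.append_assoc (forms l₂), hq, answer_seqWord]
      rfl
    have hctx2 : word pre ++ (forms [d.goal] ++ some none ::
        (forms d.endow ++ some none :: forms l₁)) ++ chars (L.enc.encode A) =
        word pre ++ (forms [d.goal] ++ some none ::
        (forms d.endow ++ some none :: (forms l₁ ++ chars (L.enc.encode A)))) := by
      simp
    rw [forms_cons A l₂, evState_append, ← hctx, form, evState_append,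
      evState_chars, evState, evState,
      hctx2, List.nil_append]
    rcases l₂ with _ | ⟨B, l₂⟩
    · refine ⟨_, rfl, ?_⟩
      rw [Bool.and_eq_true, hbit, h]
      refine and_congr_right fun _ => ⟨fun hp => ⟨hp, ?_⟩, fun hp => hp.1⟩
      intro m₁ B m₂ hs hm
      rcases m₁ with _ | ⟨C, _ | _⟩ <;> simp at hs hm
    -- Evaluation comes from the right, so the formulas after `A` are treated first; the mark on the
    -- end of `A` then tests the omission of `B`.
    · obtain ⟨k', hk, hk'⟩ := evState_choice pre d post k (B :: l₂) (l₁ ++ [A]) (by simp [h])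
        (by simp)
      rw [hk]
      refine ⟨_, rfl, ?_⟩
      rw [Bool.and_eq_true, Bool.not_eq_true', ← Bool.not_eq_true, hbit, hk']
      rw [and_assoc, and_assoc]
      refine and_congr_right fun _ => and_congr_right fun _ => ⟨?_, ?_⟩
      · rintro ⟨h1, h2⟩ m₁ C m₂ hs hm
        rcases m₁ with _ | ⟨D, m₁⟩
        · exact absurd rfl hm
        · simp only [List.cons_append, List.cons.injEq] at hs
          obtain ⟨rfl, hs⟩ := hs
          rcases m₁ with _ | ⟨D, m₁⟩
          · simp only [List.nil_append, List.cons.injEq] at hs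
            obtain ⟨rfl, rfl⟩ := hs
            simpa using h2
          · have := h1 (D :: m₁) C m₂ hs (by simp)
            simpa using this
      · intro h1
        refine ⟨fun m₁ C m₂ hs hm => ?_, ?_⟩
        · have := h1 (A :: m₁) C m₂ (by simp [hs]) (by simp)
          simpa using this
        · have := h1 [A] B l₂ rfl (by simp)
          simpa using this

theorem evState_playerWord (pre : List (PlayerData L.Form)) (d : PlayerData L.Form)
    (post : List (PlayerData L.Form)) (k : Bool) :
    ∃ k', evState answerAt (.out, k) (word pre) (playerWord d) (word post) = (.out, k') ∧
      (k' = true ↔ k = true ∧ NEInstance.Content pre d post) := by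
  have hend : ∀ p : List (Tok L.Sym), evState answerAt (.out, k) p [some none, none] (word post) =
      (.first, k) := fun p => rfl
  have hbit2 : answerAt (word pre ++ (forms [d.goal] ++ some none :: forms d.endow)) (some none)
        (forms d.choice ++ [some none, none] ++ word post) = true ↔
      L.Provable (NEInstance.outcome pre d.choice.tail post) {d.goal} := by
    rw [answerAt, query_endow, answer_seqWord]
    rfl
  have hctx : word pre ++ forms [d.goal] ++ [some none] ++ forms d.endow ++ [some none] =
      word pre ++ (forms [d.goal] ++ some none ::
        (forms d.endow ++ some none :: forms [])) := by simp
  have hctx2 : word pre ++ forms [d.goal] ++ [some none] ++ forms d.endow =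
      word pre ++ (forms [d.goal] ++ some none :: forms d.endow) := by simp
  rw [playerWord, evState_append, evState, evState_append, evState, evState_append, hend, hctx,
    hctx2]
  by_cases hc : d.choice = []
  · have hbit1 : answerAt (word pre ++ forms [d.goal]) (some none)
        (forms d.endow ++ some none :: (forms d.choice ++ [some none, none]) ++ word post) = true ↔
        L.Provable (NEInstance.outcome pre d.endow post) {d.goal} := by
      rw [answerAt, query_goal _ _ _ hc, answer_seqWord]
      rfl
    rw [hc] at hbit1 hbit2 ⊢
    have hnil : ∀ (st : Phase × Bool) (p r : List (Tok L.Sym)),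
        evState answerAt st p (forms ([] : List L.Form)) r = st := fun _ _ _ => rfl
    rw [hnil]
    simp only [evStep]
    rw [evState_forms_endow]
    simp only
    rw [evState_forms_out]
    refine ⟨_, rfl, ?_⟩
    rw [Bool.and_eq_true, Bool.or_eq_true, hbit2, Bool.not_eq_true', ← Bool.not_eq_true, hbit1,
      NEInstance.Content, hc, List.tail_nil]
    simp
    tauto
  · obtain ⟨k', hk, hk'⟩ := evState_choice pre d post k d.choice [] rfl hc
    rw [hk]
    simp only [evStep]
    rw [evState_forms_endow]
    simp only
    rw [evState_forms_out]
    refine ⟨_, rfl, ?_⟩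
    rw [Bool.true_or, Bool.and_true, Bool.and_eq_true, Bool.not_eq_true', ← Bool.not_eq_true,
      hbit2, hk', NEInstance.Content, and_assoc, and_assoc]
    refine and_congr_right fun _ => ⟨?_, ?_⟩
    · rintro ⟨h1, h2, h3⟩
      refine ⟨fun h => absurd h hc, fun _ => h1, fun l₁ A l₂ hl => ?_⟩
      rcases l₁ with _ | ⟨B, l₁⟩
      · simpa [hl] using h3
      · exact h2 (B :: l₁) A l₂ hl (by simp)
    · rintro ⟨-, h2, h3⟩
      refine ⟨h2 hc, fun m₁ A m₂ hl _ => h3 m₁ A m₂ hl, ?_⟩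
      obtain ⟨A, l, hl⟩ := List.exists_cons_of_ne_nil hc
      have := h3 [] A l hl
      simpa [hl] using this

theorem evState_word (post : List (PlayerData L.Form)) (k : Bool) :
    ∀ (l pre : List (PlayerData L.Form)),
    ∃ k', evState answerAt (.out, k) (word pre) (word l) (word post) = (.out, k') ∧
      (k' = true ↔ k = true ∧ ∀ m₁ d m₂, l = m₁ ++ d :: m₂ →
        NEInstance.Content (pre ++ m₁) d (m₂ ++ post))
  | [], pre => ⟨k, rfl, by simp⟩
  | d :: l, pre => by
    obtain ⟨k₁, h1, h2⟩ := evState_word post k l (pre ++ [d])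
    obtain ⟨k₂, h3, h4⟩ := evState_playerWord pre d (l ++ post) k₁
    refine ⟨k₂, ?_, ?_⟩
    · rw [word_cons, evState_append, ← h3, ← h1]
      simp
    · rw [h4, h2, and_assoc]
      refine and_congr_right fun _ => ⟨?_, ?_⟩
      · rintro ⟨h5, h6⟩ m₁ e m₂ hl
        rcases m₁ with _ | ⟨f, m₁⟩
        · simp only [List.nil_append, List.cons.injEq] at hl
          obtain ⟨rfl, rfl⟩ := hl
          simpa using h6
        · simp only [List.cons_append, List.cons.injEq] at hl
          obtain ⟨rfl, hl⟩ := hl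
          have := h5 m₁ e m₂ hl
          simpa using this
      · intro h5
        refine ⟨fun m₁ e m₂ hl => ?_, ?_⟩
        · have := h5 (d :: m₁) e m₂ (by simp [hl])
          simpa using this
        · have := h5 [] d l rfl
          simpa using this

/-- The queries about an instance: a dummy, and one for each position of its description. -/
noncomputable def askAll (I : NEInstance L) : List L.validity.Inst :=
  -- The first pass of the query writer merely places the mark but already emits a sequent, the
  -- dummy. The mark then travels from right to left, hence the reversal.
  toSeq (seqWord [] []) :: ((queries [] (word I.players) []).reverse.map toSeq)

/-- Decision from the answers. -/
def judgeWord (w : List (Tok L.Sym)) (bits : List Bool) : Bool :=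
  (evList (.out, true) w.reverse bits.tail).2

theorem mem_queries {S : Type} {y : List (Tok S)} : ∀ {p u r : List (Tok S)},
    y ∈ queries p u r → ∃ p' s r', p' ++ s :: r' = p ++ u ++ r ∧ y = query p' s r'
  | _, [], _, h => by cases h
  | p, s :: u, r, h => by
    rcases List.mem_cons.1 h with rfl | h
    · exact ⟨p, s, u ++ r, by simp, rfl⟩
    · obtain ⟨p', s', r', h1, h2⟩ := mem_queries h
      exact ⟨p', s', r', by simpa using h1, h2⟩

/-- Since each query is well-formed, decoding and encoding it again gives back the word that the
machine actually writes. -/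
theorem listWord_askAll (I : NEInstance L) :
    listWord L.validity.enc (askAll I) =
      (seqWord [] [] ++ [none]) ++
        (queries [] (word I.players) []).reverse.flatMap fun y => y ++ [none] := by
  have h : ∀ Γ Δ : List L.Form,
      (L.validity.enc.encode (toSeq (seqWord Γ Δ))).map some = seqWord Γ Δ := by
    intro Γ Δ
    rw [toSeq_seqWord]
    exact map_some_enc_validity Γ Δ
  rw [listWord, askAll, List.flatMap_cons, List.flatMap_map, h]
  refine congrArg _ (List.flatMap_congr fun y hy => ?_)
  obtain ⟨p, s, r, h1, rfl⟩ := mem_queries (List.mem_reverse.1 hy)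
  obtain ⟨Γ, Δ, h2⟩ := exists_query_eq (by simpa using h1)
  rw [h2, h]
  rfl

theorem yes_iff_judgeWord (hW : L.Affine) (I : NEInstance L) :
    (nashEquilibrium L).Yes I ↔
      judgeWord (word I.players) ((askAll I).map L.validity.answer) = true := by
  have h1 := evList_queries answer (.out, true) [] (word I.players) [] []
  obtain ⟨k, h2, h3⟩ := evState_word [] true I.players []
  have h4 : judgeWord (word I.players) ((askAll I).map L.validity.answer) = k := by
    have : ((askAll I).map L.validity.answer).tail =
        ((queries [] (word I.players) []).map answer).reverse := by
      simp [askAll, List.map_reverse, Function.comp_def, answer]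
    rw [judgeWord, this, ← List.append_nil (List.reverse (List.map _ _)), h1]
    exact congrArg Prod.snd h2
  rw [h4, h3]
  refine (NEInstance.mem_NE_iff hW I).trans ?_
  simp

end

/-! ### The machine that writes the queries -/

/-- Push the symbol `f v`, if there is one; do nothing otherwise. -/
noncomputable def pushOpt {K : Type} {Γ : K → Type} {Λ σ : Type} (k : K) (f : σ → Option (Γ k))
    (q : TM2.Stmt Γ Λ σ) : TM2.Stmt Γ Λ σ :=
  .branch (fun v => (f v).isSome) (pushSome k f q) q

theorem stepAux_pushOpt {K : Type} [DecidableEq K] {Γ : K → Type} {Λ σ : Type} {k : K}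
    {f : σ → Option (Γ k)} {q : TM2.Stmt Γ Λ σ} {v : σ} {S : ∀ k, List (Γ k)} :
    TM2.stepAux (pushOpt k f q) v S =
      TM2.stepAux q v (Function.update S k ((f v).toList ++ S k)) := by
  cases h : f v with
  | none => simp [pushOpt, h]
  | some a => simp [pushOpt, h, stepAux_pushSome h]

/-- Move the mark one position to the left; the flags say whether the symbol to the right of the
word, and the first symbol of the word, are marked. -/
def shift {α : Type} (c : Bool) : List (α × Bool) → List (α × Bool) × Bool
  | [] => ([], c)
  | x :: w => ((x.1, (shift c w).2) :: (shift c w).1, x.2)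

/-- The recursion from the right end, the order in which the machine pops the word. -/
theorem shift_concat {α : Type} (c : Bool) (u : List (α × Bool)) (x : α × Bool) :
    shift c (u ++ [x]) = ((shift x.2 u).1 ++ [(x.1, c)], (shift x.2 u).2) := by
  induction u with
  | nil => rfl
  | cons y u ih => simp [shift, ih]

section

variable {S : Type}

theorem shift_plain (w : List (Tok S)) : shift false (plain w) = (plain w, false) := by
  induction w with
  | nil => rfl
  | cons a w ih => simp [shift, ih]

theorem shift_marked_nil (s : Tok S) (r : List (Tok S)) :
    shift false (marked [] s r) = (plain (s :: r), true) := by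
  simp [marked, shift, shift_plain]

theorem shift_marked_concat (p : List (Tok S)) (t s : Tok S) (r : List (Tok S)) :
    shift false (marked (p ++ [t]) s r) = (marked p t (s :: r), false) := by
  induction p with
  | nil => simp [marked, shift, shift_plain]
  | cons a p ih =>
    simp only [marked, List.cons_append, plain_cons, shift] at ih ⊢
    rw [ih]

theorem shift_true_plain (p : List (Tok S)) (s : Tok S) :
    shift true (plain (p ++ [s])) = (marked p s [], false) := by
  rw [plain_append, plain_cons, plain_nil, shift_concat, shift_plain]
  rfl

end

namespace Ask

variable (S : Type)

/-- Stacks. -/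
inductive Stk
  | io | a | b | g | o
  deriving DecidableEq

instance : Fintype Stk := ⟨{.io, .a, .b, .g, .o}, by intro x; cases x <;> simp⟩

/-- Labels. -/
inductive Lab
  | init | back | goal | fwd | clear | out
  deriving DecidableEq

instance : Fintype Lab :=
  ⟨{.init, .back, .goal, .fwd, .clear, .out}, by intro x; cases x <;> simp⟩

/-- Stack symbols. -/
abbrev Sym : Stk → Type
  | .io => Tok S
  | .a => Tok S × Bool
  | .b => Tok S × Bool
  | .g => Tok S
  | .o => Tok S

/-- Internal states: the last symbol read, the state of the transducer, the travelling mark. -/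
abbrev St := Option (Tok S × Bool) × (Part × Bool) × Bool

/-- The program. -/
noncomputable def code : Lab → TM2.Stmt (Sym S) Lab (St S)
  | .init => .pop .io (fun v s => (s.map fun t => (t, false), v.2)) <|
      .branch (fun v => v.1.isSome)
        (pushOpt .b (fun v => v.1) <| .goto fun _ => .init)
        (.push .o (fun _ => some none) <| .goto fun _ => .back)
  -- One pass does two things: it extracts the goal using the old marks, and pushes each symbol back
  -- with the mark of its right neighbour.
  | .back => .pop .b (fun v s => (s, v.2)) <|
      .branch (fun v => v.1.isSome)
        (pushOpt .a (fun v => v.1.map fun x => (x.1, v.2.2)) <|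
          pushOpt .g (fun v => v.1.bind fun x => bwdEmit v.2.1 x.1) <|
          .load (fun v => v.1.elim v fun x => (v.1, bwdStep v.2.1 x, x.2)) <|
          .goto fun _ => .back)
        (.load (fun v => (v.1, (.goal, false), v.2.2)) <| .goto fun _ => .goal)
  | .goal => .pop .g (fun v s => (s.map fun t => (t, false), v.2)) <|
      .branch (fun v => v.1.isSome)
        (pushOpt .o (fun v => v.1.map Prod.fst) <| .goto fun _ => .goal)
        (.push .o (fun _ => some none) <| .push .o (fun _ => none) <|
          -- The flag is set once the mark has left the word on the left.
          .goto fun v => if v.2.2 then .clear else .fwd)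
  | .fwd => .pop .a (fun v s => (s, v.2)) <|
      .branch (fun v => v.1.isSome)
        (pushOpt .b (fun v => v.1) <|
          pushOpt .o (fun v => v.1.bind fun x => emit v.2.1.2 x.1) <|
          .load (fun v => v.1.elim v fun x => (v.1, fwdStep v.2.1 x, v.2.2)) <|
          .goto fun _ => .fwd)
        (.load (fun v => (v.1, (.goal, false), v.2.2)) <|
          .push .o (fun _ => some none) <| .goto fun _ => .back)
  | .clear => .pop .a (fun v s => (s, v.2)) <|
      .branch (fun v => v.1.isSome) (.goto fun _ => .clear) (.goto fun _ => .out)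
  | .out => .pop .o (fun v s => (s.map fun t => (t, false), v.2)) <|
      .branch (fun v => v.1.isSome)
        (pushOpt .io (fun v => v.1.map Prod.fst) <| .goto fun _ => .out)
        .halt

/-- The machine. -/
noncomputable def machine [Fintype S] : FinTM2 where
  K := Stk
  k₀ := .io
  k₁ := .io
  Γ := Sym S
  Λ := Lab
  main := .init
  σ := St S
  -- The flag `true` puts the first mark on the last symbol. It is `true` again when the mark leaves
  -- the word, so the machine halts in its initial state, as `haltList` requires.
  initialState := (none, (.goal, false), true)
  Γk₀Fin := inferInstanceAs (Fintype (Tok S))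
  m := code S

variable {S}

/-- Stack contents. -/
def stks (io : List (Tok S)) (a b : List (Tok S × Bool)) (g o : List (Tok S)) :
    ∀ k, List (Sym S k)
  | .io => io
  | .a => a
  | .b => b
  | .g => g
  | .o => o

theorem update_io (io a b g o) (l : List (Tok S)) :
    Function.update (stks io a b g o) .io l = stks l a b g o := by
  funext k
  cases k <;> rfl

theorem update_a (io a b g o) (l : List (Tok S × Bool)) :
    Function.update (stks io a b g o) .a l = stks io l b g o := by
  funext k
  cases k <;> rfl

theorem update_b (io a b g o) (l : List (Tok S × Bool)) :
    Function.update (stks io a b g o) .b l = stks io a l g o := by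
  funext k
  cases k <;> rfl

theorem update_g (io a b g o) (l : List (Tok S)) :
    Function.update (stks io a b g o) .g l = stks io a b l o := by
  funext k
  cases k <;> rfl

theorem update_o (io a b g o) (l : List (Tok S)) :
    Function.update (stks io a b g o) .o l = stks io a b g l := by
  funext k
  cases k <;> rfl

/-- Configurations. -/
def cfg (l : Lab) (x : Option (Tok S × Bool)) (st : Part × Bool) (c : Bool) (io : List (Tok S))
    (a b : List (Tok S × Bool)) (g o : List (Tok S)) : TM2.Cfg (Sym S) Lab (St S) :=
  ⟨some l, (x, st, c), stks io a b g o⟩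

/-- One step of the program. -/
local notation "step" => TM2.step (code S)

theorem run_init : ∀ (w : List (Tok S)) (x b),
    StepsWithin step (w.length + 1) (cfg .init x (.goal, false) true w [] b [] [])
      (cfg .back none (.goal, false) true [] [] ((plain w).reverse ++ b) [] [some none])
  | [], x, b => by
    refine .single ?_
    simp [cfg, code, stks, update_io, update_o]
  | t :: w, x, b => by
    refine .head (b := cfg .init (some (t, false)) (.goal, false) true w [] ((t, false) :: b) [] [])
      ?_ ?_
    · simp [cfg, code, stks, update_io, update_b, stepAux_pushOpt]
    · simpa using run_init w (some (t, false)) ((t, false) :: b)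

theorem run_back (o) : ∀ (y : List (Tok S × Bool)) (x a g st c),
    StepsWithin step (y.length + 1) (cfg .back x st c [] a y g o)
      (cfg .goal none (.goal, false) (shift c y.reverse).2 [] ((shift c y.reverse).1 ++ a) []
        (bwdOut st y.reverse ++ g) o)
  | [], x, a, g, st, c => by
    refine .single ?_
    simp [cfg, code, stks, update_b, shift, bwdOut]
  | z :: y, x, a, g, st, c => by
    refine .head (b := cfg .back (some z) (bwdStep st z) z.2 [] ((z.1, c) :: a) y
      ((bwdEmit st z.1).toList ++ g) o) ?_ ?_
    · simp [cfg, code, stks, update_b, update_a, update_g, stepAux_pushOpt]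
    · have := run_back o y (some z) ((z.1, c) :: a) ((bwdEmit st z.1).toList ++ g)
        (bwdStep st z) z.2
      simpa [shift_concat, bwdOut_append, bwdState, bwdOut] using this

theorem run_goal (st a c) : ∀ (g o : List (Tok S)) (x),
    StepsWithin step (g.length + 1) (cfg .goal x st c [] a [] g o)
      (cfg (if c then .clear else .fwd) none st c [] a [] []
        (none :: some none :: (g.reverse ++ o)))
  | [], o, x => by
    refine .single ?_
    simp [cfg, code, stks, update_g, update_o]
  | t :: g, o, x => by
    refine .head (b := cfg .goal (some (t, false)) st c [] a [] g (t :: o)) ?_ ?_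
    · simp [cfg, code, stks, update_g, update_o, stepAux_pushOpt]
    · simpa using run_goal st a c g (t :: o) (some (t, false))

theorem run_fwd (c) : ∀ (a b : List (Tok S × Bool)) (o x st),
    StepsWithin step (a.length + 1) (cfg .fwd x st c [] a b [] o)
      (cfg .back none (.goal, false) c [] [] (a.reverse ++ b) []
        (some none :: ((fwdOut st a).reverse ++ o)))
  | [], b, o, x, st => by
    refine .single ?_
    simp [cfg, code, stks, update_a, update_o, fwdOut]
  | z :: a, b, o, x, st => by
    refine .head (b := cfg .fwd (some z) (fwdStep st z) c [] a (z :: b) []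
      ((emit st.2 z.1).toList ++ o)) ?_ ?_
    · simp [cfg, code, stks, update_b, update_a, update_o, stepAux_pushOpt]
    · have := run_fwd c a (z :: b) ((emit st.2 z.1).toList ++ o) (some z) (fwdStep st z)
      have h : (emit st.2 z.1).toList.reverse = (emit st.2 z.1).toList := by
        cases emit st.2 z.1 <;> rfl
      simpa [fwdOut, h] using this

theorem run_clear (st c) : ∀ (a : List (Tok S × Bool)) (o x),
    StepsWithin step (a.length + 1) (cfg .clear x st c [] a [] [] o)
      (cfg .out none st c [] [] [] [] o)
  | [], o, x => by
    refine .single ?_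
    simp [cfg, code, stks, update_a]
  | z :: a, o, x => by
    refine .head (b := cfg .clear (some z) st c [] a [] [] o) ?_ (run_clear st c a o (some z))
    simp [cfg, code, stks, update_a]

theorem run_out (st c) : ∀ (o w : List (Tok S)) (x),
    StepsWithin step (o.length + 1) (cfg .out x st c w [] [] [] o)
      ⟨none, (none, st, c), stks (o.reverse ++ w) [] [] [] []⟩
  | [], w, x => by
    refine .single ?_
    simp [cfg, code, stks, update_o]
  | t :: o, w, x => by
    refine .head (b := cfg .out (some (t, false)) st c (t :: w) [] [] [] o) ?_ ?_
    · simp [cfg, code, stks, update_o, update_io, stepAux_pushOpt]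
    · simpa using run_out st c o (t :: w) (some (t, false))

theorem length_fwdOut_le (st : Part × Bool) (w : List (Tok S × Bool)) :
    (fwdOut st w).length ≤ w.length := by
  induction w generalizing st with
  | nil => simp [fwdOut]
  | cons a w ih =>
    have h : (emit st.2 a.1).toList.length ≤ 1 := by cases emit st.2 a.1 <;> simp
    have := ih (fwdStep st a)
    simp only [fwdOut, List.length_append, List.length_cons]
    omega

theorem length_bwdOut_le (st : Part × Bool) (w : List (Tok S × Bool)) :
    (bwdOut st w).length ≤ w.length := by
  induction w with
  | nil => simp [bwdOut]
  | cons a w ih =>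
    have h : (bwdEmit (bwdState st w) a.1).toList.length ≤ 1 := by
      cases bwdEmit (bwdState st w) a.1 <;> simp
    simp only [bwdOut, List.length_append, List.length_cons]
    omega

theorem length_query_le (p : List (Tok S)) (s : Tok S) (r : List (Tok S)) :
    (query p s r).length ≤ 2 * (p.length + 1 + r.length) + 2 := by
  have h1 := length_fwdOut_le (.goal, false) (marked p s r)
  have h2 := length_bwdOut_le (.goal, false) (marked p s r)
  have h3 : (marked p s r).length = p.length + 1 + r.length := by
    simp [marked, plain]
    omega
  simp only [query, List.length_append, List.length_cons, List.length_nil]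
  omega

/-- The antecedent goes straight to `o`; the goal is found in reverse order, so it is buffered on
`g` and then moved to `o`. -/
theorem run_round (p : List (Tok S)) (s : Tok S) (r : List (Tok S)) (o) :
    StepsWithin step (3 * (p.length + 1 + r.length) + 3)
      (cfg .fwd none (.goal, false) false [] (marked p s r) [] [] o)
      (cfg (if (shift false (marked p s r)).2 then .clear else .fwd) none (.goal, false)
        (shift false (marked p s r)).2 [] (shift false (marked p s r)).1 [] []
        ((query p s r ++ [none]).reverse ++ o)) := by
  have h3 : (marked p s r).length = p.length + 1 + r.length := by
    simp [marked, plain]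
    omega
  have h1 := run_fwd false (marked p s r) [] o none (.goal, false)
  have h2 := run_back (some none :: ((fwdOut (.goal, false) (marked p s r)).reverse ++ o))
    ((marked p s r).reverse ++ []) none [] [] (.goal, false) false
  simp only [List.append_nil, List.reverse_reverse] at h1 h2
  have h4 := run_goal (.goal, false) (shift false (marked p s r)).1 (shift false (marked p s r)).2
    (bwdOut (.goal, false) (marked p s r))
    (some none :: ((fwdOut (.goal, false) (marked p s r)).reverse ++ o)) none
  have h5 := length_bwdOut_le (.goal, false) (marked p s r)
  have h := (h1.trans (h2.trans h4)).mono (m := 3 * (p.length + 1 + r.length) + 3)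
    (by rw [List.length_reverse]; omega)
  simpa [query] using h

/-- The rounds for the marks from the last position of `p s` to the first position. -/
theorem run_rounds (n : ℕ) : ∀ (p : List (Tok S)) (s : Tok S) (r : List (Tok S)) (o),
    p.length + 1 + r.length = n →
    StepsWithin step ((p.length + 1) * (3 * n + 3))
      (cfg .fwd none (.goal, false) false [] (marked p s r) [] [] o)
      (cfg .clear none (.goal, false) true [] (plain (p ++ s :: r)) [] []
        (((queries [] (p ++ [s]) r).reverse.flatMap fun y => y ++ [none]).reverse ++ o)) := by
  intro p
  induction p using List.reverseRecOn with
  | nil =>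
    rintro s r o rfl
    have := run_round [] s r o
    rw [shift_marked_nil] at this
    refine (this.mono (by simp)).trans (m := 0) ?_
    simpa [queries] using StepsWithin.refl _ _
  | append_singleton p t ih =>
    intro s r o hn
    rw [List.length_append, List.length_singleton] at hn
    have h1 := run_round (p ++ [t]) s r o
    rw [shift_marked_concat, List.length_append, List.length_singleton, hn] at h1
    have h2 := ih t (s :: r) ((query (p ++ [t]) s r ++ [none]).reverse ++ o)
      (by rw [List.length_cons]; omega)
    have h := (h1.trans h2).mono (m := ((p ++ [t]).length + 1) * (3 * n + 3))
      (by rw [List.length_append, List.length_singleton]; ring_nf; omega)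
    rw [queries_append [] (p ++ [t]) [s] r]
    simpa [queries] using h

/-- Both transducers emit at most one symbol per symbol read, so a query has at most `2 * n + 2`
symbols, and one separator follows it. -/
theorem length_queries_flatMap_le (n : ℕ) : ∀ (p u r : List (Tok S)),
    p.length + u.length + r.length = n →
    ((queries p u r).reverse.flatMap fun y => y ++ [none]).length ≤ u.length * (2 * n + 3)
  | p, [], r, _ => by simp [queries]
  | p, s :: u, r, h => by
    rw [List.length_cons] at h
    have ih := length_queries_flatMap_le n (p ++ [s]) u r
      (by rw [List.length_append, List.length_singleton]; omega)
    have h1 := length_query_le p s (u ++ r)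
    rw [List.length_append] at h1
    rw [queries, List.reverse_cons, List.flatMap_append, List.length_append, List.length_cons,
      Nat.succ_mul]
    refine Nat.add_le_add ih ?_
    simp only [List.flatMap_cons, List.flatMap_nil, List.length_append, List.length_cons,
      List.length_nil]
    omega

theorem run_machine (w : List (Tok S)) (hw : bwdOut (.goal, false) (plain w) = []) :
    StepsWithin step (5 * w.length ^ 2 + 11 * w.length + 9)
      (cfg .init none (.goal, false) true w [] [] [] [])
      ⟨none, (none, (.goal, false), true), stks ([some none, some none, none] ++
        (queries [] w []).reverse.flatMap fun y => y ++ [none]) [] [] [] []⟩ := by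
  have h1 := run_init w none []
  have h2 := run_back [some none] ((plain w).reverse ++ []) none [] [] (.goal, false) true
  simp only [List.append_nil, List.reverse_reverse] at h1 h2
  rw [hw] at h2
  have h3 := run_goal (.goal, false) (shift true (plain w)).1 (shift true (plain w)).2 []
    [some none] none
  have h123 := h1.trans (h2.trans h3)
  have hlen : (plain w).length = w.length := by simp [plain]
  rw [List.length_reverse, hlen] at h123
  have h4 : StepsWithin step (w.length * (3 * w.length + 3))
      (cfg (if (shift true (plain w)).2 then .clear else .fwd) none (.goal, false)
        (shift true (plain w)).2 [] (shift true (plain w)).1 [] []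
        (none :: some none :: ([].reverse ++ [some none])))
      (cfg .clear none (.goal, false) true [] (plain w) [] []
        (((queries [] w []).reverse.flatMap fun y => y ++ [none]).reverse ++
          [none, some none, some none])) := by
    rcases List.eq_nil_or_concat w with rfl | ⟨p, s, rfl⟩
    -- On the empty word the flag is still set and the loop is skipped.
    · exact .refl _ _
    · rw [List.concat_eq_append, shift_true_plain]
      have := run_rounds (p.length + 1) p s [] [none, some none, some none] (by simp)
      simpa using this
  have h5 := run_clear (.goal, false) true (plain w)
    (((queries [] w []).reverse.flatMap fun y => y ++ [none]).reverse ++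
      [none, some none, some none]) none
  have h6 := run_out (.goal, false) true
    (((queries [] w []).reverse.flatMap fun y => y ++ [none]).reverse ++
      [none, some none, some none]) [] none
  have h7 := length_queries_flatMap_le w.length [] w [] (by simp)
  have h := (h123.trans (h4.trans (h5.trans h6))).mono (m := 5 * w.length ^ 2 + 11 * w.length + 9)
    (by
      rw [hlen, List.length_append, List.length_reverse]
      simp only [List.length_cons, List.length_nil]
      nlinarith)
  simpa using h

/-- The run from an input to an output, both of them written on the first stack. -/
theorem run_lists {u v : List (Tok S)} (w : List (Tok S)) [Fintype S] (hu : u = w)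
    (hv : v = [some none, some none, none] ++
      (queries [] w []).reverse.flatMap fun y => y ++ [none])
    (hw : bwdOut (.goal, false) (plain w) = []) :
    StepsWithin (machine S).step (5 * u.length ^ 2 + 11 * u.length + 9)
      (initList (machine S) (u.map id)) (haltList (machine S) (v.map id)) := by
  have hin : initList (machine S) (u.map id) =
      cfg .init none (.goal, false) true u [] [] [] [] := by
    refine (initList_eq _ _).trans (congrArg (TM2.Cfg.mk _ _) ?_)
    funext k
    cases k
    · exact List.map_id u
    all_goals rfl
  have hout : haltList (machine S) (v.map id) =
      ⟨none, (none, (.goal, false), true), stks v [] [] [] []⟩ := by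
    refine (haltList_eq _ _).trans (congrArg (TM2.Cfg.mk _ _) ?_)
    funext k
    cases k
    · exact List.map_id v
    all_goals rfl
  have h := run_machine w hw
  rw [← hv, ← hu] at h
  exact (congrArg₂ (StepsWithin (machine S).step _) hin hout).mpr h

end Ask

theorem polyTime_of_stepsWithin {α β Γ₁ Γ₂ : Type} {ea : Encoding α Γ₁} {eb : Encoding β Γ₂}
    {f : α → β} (M : TM2ComputableAux Γ₁ Γ₂) (p : Polynomial ℕ)
    (h : ∀ a, StepsWithin M.tm.step (p.eval (ea.encode a).length)
      (initList M.tm ((ea.encode a).map M.inputAlphabet.symm))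
      (haltList M.tm ((eb.encode (f a)).map M.outputAlphabet.symm))) :
    PolyTime ea eb f :=
  ⟨⟨M, p, fun a => (h a).evalsToInTime.some⟩⟩

theorem polyTime_askAll (L : ResourceLogic) :
    PolyTime (NEInstance.enc L) (listEnc L.validity.enc) askAll := by
  refine polyTime_of_stepsWithin ⟨Ask.machine L.Sym, Equiv.refl _, Equiv.refl _⟩
    (5 * Polynomial.X ^ 2 + 11 * Polynomial.X + 9) fun I => ?_
  refine (Ask.run_lists (word I.players) (enc_eq_word I) (listWord_askAll I)
    (bwd_plain_word false I.players).2.2).mono (le_of_eq ?_)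
  simp

/-! ### The machine that evaluates the answers -/

namespace Judge

variable (S : Type)

/-- Stacks. -/
inductive Stk
  | i | t | o
  deriving DecidableEq

instance : Fintype Stk := ⟨{.i, .t, .o}, by intro x; cases x <;> simp⟩

/-- Labels. -/
inductive Lab
  | load | eval | clear
  deriving DecidableEq

instance : Fintype Lab := ⟨{.load, .eval, .clear}, by intro x; cases x <;> simp⟩

/-- Stack symbols. -/
abbrev Sym : Stk → Type
  | .i => Tok S ⊕ Bool
  | .t => Tok S
  | .o => Bool

/-- Internal states: the last symbol and the last answer read, the state of the evaluation. -/
abbrev St := Option (Tok S) × Option Bool × (Phase × Bool)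

/-- The program. -/
noncomputable def code : Lab → TM2.Stmt (Sym S) Lab (St S)
  -- The loop notices the end of the word by popping the first bit, if any; this discards the answer
  -- to the dummy.
  | .load => .pop .i (fun v s => (s.bind Sum.getLeft?, none, v.2.2)) <|
      .branch (fun v => v.1.isSome)
        (pushOpt .t (fun v => v.1) <| .goto fun _ => .load)
        (.goto fun _ => .eval)
  | .eval => .pop .t (fun v s => (s, none, v.2.2)) <|
      .branch (fun v => v.1.isSome)
        (.pop .i (fun v s => (v.1, s.bind Sum.getRight?, v.2.2)) <|
          -- A missing answer counts as `false`, in agreement with `headD false` in `evList`.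
          .load (fun v => v.1.elim v fun s => (none, none, evStep v.2.2 (s, v.2.1.getD false))) <|
          .goto fun _ => .eval)
        (.goto fun _ => .clear)
  -- The stored Boolean only records that something was popped; superfluous answers must go because
  -- only the output may remain at the halt.
  | .clear => .pop .i (fun v s => (none, s.map fun _ => false, v.2.2)) <|
      .branch (fun v => v.2.1.isSome) (.goto fun _ => .clear)
        (.push .o (fun v => v.2.2.2) <| .load (fun _ => (none, none, (.out, true))) .halt)

/-- The machine. -/
noncomputable def machine [Fintype S] : FinTM2 where
  K := Stk
  k₀ := .i
  k₁ := .o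
  Γ := Sym S
  Λ := Lab
  main := .load
  σ := St S
  initialState := (none, none, (.out, true))
  Γk₀Fin := inferInstanceAs (Fintype (Tok S ⊕ Bool))
  m := code S

variable {S}

/-- Stack contents. -/
def stks (i : List (Tok S ⊕ Bool)) (t : List (Tok S)) (o : List Bool) : ∀ k, List (Sym S k)
  | .i => i
  | .t => t
  | .o => o

theorem update_i (i t o) (l : List (Tok S ⊕ Bool)) :
    Function.update (stks i t o) .i l = stks l t o := by
  funext k
  cases k <;> rfl

theorem update_t (i t o) (l : List (Tok S)) :
    Function.update (stks i t o) .t l = stks i l o := by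
  funext k
  cases k <;> rfl

theorem update_o (i) (t : List (Tok S)) (o l) :
    Function.update (stks i t o) .o l = stks i t l := by
  funext k
  cases k <;> rfl

/-- Configurations. -/
def cfg (l : Lab) (st : Phase × Bool) (i : List (Tok S ⊕ Bool)) (t : List (Tok S))
    (x : Option (Tok S)) : TM2.Cfg (Sym S) Lab (St S) :=
  ⟨some l, (x, none, st), stks i t []⟩

/-- One step of the program. -/
local notation "step" => TM2.step (code S)

theorem run_load (st) (bits : List Bool) : ∀ (w t : List (Tok S)) (x),
    StepsWithin step (w.length + 1) (cfg .load st (w.map .inl ++ bits.map .inr) t x)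
      (cfg .eval st (bits.tail.map .inr) (w.reverse ++ t) none)
  | [], t, x => by
    refine .single ?_
    cases bits <;> simp [cfg, code, stks, update_i]
  | s :: w, t, x => by
    refine .head (b := cfg .load st (w.map .inl ++ bits.map .inr) (s :: t) (some s)) ?_ ?_
    · simp [cfg, code, stks, update_i, update_t, stepAux_pushOpt]
    · simpa using run_load st bits w (s :: t) (some s)

theorem run_eval : ∀ (t : List (Tok S)) (bits : List Bool) (st),
    StepsWithin step (t.length + 1) (cfg .eval st (bits.map .inr) t none)
      (cfg .clear (evList st t bits) ((bits.drop t.length).map .inr) [] none)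
  | [], bits, st => by
    refine .single ?_
    simp [cfg, code, stks, update_t, evList]
  | s :: t, bits, st => by
    refine .head (b := cfg .eval (evStep st (s, bits.headD false)) (bits.tail.map .inr) t none)
      ?_ ?_
    · cases bits <;> simp [cfg, code, stks, update_i, update_t]
    · simpa [evList] using run_eval t bits.tail (evStep st (s, bits.headD false))

theorem run_clear (st) : ∀ (i : List (Tok S ⊕ Bool)) (y),
    StepsWithin step (i.length + 1) ⟨some .clear, (none, y, st), stks i [] []⟩
      ⟨none, (none, none, (.out, true)), stks [] [] [st.2]⟩
  | [], y => by
    refine .single ?_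
    simp [code, stks, update_i, update_o]
  | s :: i, y => by
    refine .head (b := ⟨some .clear, (none, some false, st), stks i [] []⟩) ?_
      (run_clear st i (some false))
    simp [code, stks, update_i]

theorem run_machine (w : List (Tok S)) (bits : List Bool) :
    StepsWithin step (2 * (w.length + bits.length) + 3)
      (cfg .load (.out, true) (w.map .inl ++ bits.map .inr) [] none)
      ⟨none, (none, none, (.out, true)),
        stks [] [] [(evList (.out, true) w.reverse bits.tail).2]⟩ := by
  have h1 := run_load (.out, true) bits w [] none
  have h2 := run_eval (w.reverse ++ []) bits.tail (.out, true)
  have h3 := run_clear (S := S) (evList (.out, true) (w.reverse ++ []) bits.tail)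
    ((bits.tail.drop (w.reverse ++ []).length).map .inr) none
  have h := (h1.trans (h2.trans h3)).mono (m := 2 * (w.length + bits.length) + 3) (by
    simp only [List.length_map, List.length_drop, List.length_tail, List.length_append,
      List.length_reverse, List.length_nil]
    omega)
  simpa using h

/-- The run from an input on the first stack to an output on the last one. -/
theorem run_lists [Fintype S] {u : List (Tok S ⊕ Bool)} (w : List (Tok S)) (bits : List Bool)
    (hu : u = w.map .inl ++ bits.map .inr) :
    StepsWithin (machine S).step (2 * u.length + 3) (initList (machine S) (u.map id))
      (haltList (machine S) ([(evList (.out, true) w.reverse bits.tail).2].map id)) := by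
  have hin : initList (machine S) (u.map id) = cfg .load (.out, true) u [] none := by
    refine (initList_eq _ _).trans (congrArg (TM2.Cfg.mk _ _) ?_)
    funext k
    cases k
    · exact List.map_id u
    all_goals rfl
  have hout : haltList (machine S) ([(evList (.out, true) w.reverse bits.tail).2].map id) =
      ⟨none, (none, none, (.out, true)),
        stks [] [] [(evList (.out, true) w.reverse bits.tail).2]⟩ := by
    refine (haltList_eq _ _).trans (congrArg (TM2.Cfg.mk _ _) ?_)
    funext k
    cases k <;> rfl
  have h := run_machine w bits
  rw [← hu] at h
  have hl : u.length = w.length + bits.length := by simp [hu]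
  rw [hl]
  exact (congrArg₂ (StepsWithin (machine S).step _) hin hout).mpr h

end Judge

theorem polyTime_judgeWord (L : ResourceLogic) :
    PolyTime (withBits (NEInstance.enc L)) encodingBoolBool
      (fun p => judgeWord (word p.1.players) p.2) := by
  refine polyTime_of_stepsWithin ⟨Judge.machine L.Sym, Equiv.refl _, Equiv.refl _⟩
    (2 * Polynomial.X + 3) fun p => ?_
  have h : (withBits (NEInstance.enc L)).encode p =
      (word p.1.players).map .inl ++ p.2.map .inr := by
    rw [← enc_eq_word]
    rfl
  refine (Judge.run_lists (word p.1.players) p.2 h).mono (le_of_eq ?_)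
  simp

theorem inParallelP_nashEquilibrium {C : DecisionProblem → Prop} {L : ResourceLogic}
    (hW : L.Affine) (h : C L.validity) : InParallelP C (nashEquilibrium L) :=
  ⟨L.validity, h, askAll, fun p => judgeWord (word p.1.players) p.2, polyTime_askAll L,
    polyTime_judgeWord L, yes_iff_judgeWord hW⟩

end IRG

theorem mainTheorem10 (LOG : IRG.ResourceLogic) (hW : LOG.Affine) :
    (∀ (G : IRG.Game LOG) (P : Fin G.n → Multiset LOG.Form), P ∈ G.profiles →
      (P ∉ G.NE ↔ ∃ i : Fin G.n,
        (¬ LOG.Provable (G.out P) {G.goal i} ∧ P i ≠ 0) ∨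
        (¬ LOG.Provable (G.out P) {G.goal i} ∧
          LOG.Provable (G.out (G.deviate P i (G.endow i))) {G.goal i}) ∨
        (LOG.Provable (G.out P) {G.goal i} ∧
          ∃ A ∈ P i, LOG.Provable (G.out (G.deviate P i ((P i).erase A))) {G.goal i}))) ∧
    (IRG.InNP LOG.validity → IRG.InParallelP IRG.InNP (IRG.nashEquilibrium LOG)) ∧
    (IRG.InPSPACE LOG.validity → IRG.InPSPACE (IRG.nashEquilibrium LOG)) :=
  ⟨fun G P hP => G.not_mem_NE_iff hW P hP, IRG.inParallelP_nashEquilibrium hW,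
    fun h => (IRG.inParallelP_nashEquilibrium hW h).inPSPACE⟩
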